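/- Conventions. Alphabets are finite. A cellular automaton (CA) on an alphabet $X$ is given by an anchor $m\in\mathbb Z$, a diameter $d\ge 1$ and a local rule $f:X^d\to X$; its global map is $F:X^{\mathbb Z}\to X^{\mathbb Z}$, $F(x)_i=f(x_{i-m},\dots,x_{i-m+d-1})$, and its trace is $\tau_F=\{(F^j(x)_0)_{j\in\mathbb N} : x\in X^{\mathbb Z}\}$. A (onesided) subshift on $A$ is a closed set $\Sigma\subseteq A^{\mathbb N}$ with $\sigma(\Sigma)\subseteq\Sigma$, where $\sigma$ is the shift; it is sofic if it is the set of labels of the infinite paths of some finite edge-labelled graph, called a graph of $\Sigma$. A CA $G$ of anchor $0$ and diameter $2$ on an alphabet $B\subseteq A^k$, for some $k$, polytraces $\Sigma$ if $\Sigma=\bigcup_{0\le q<k}\pi_q(\tau_G)$, where $\pi_q$ takes the $q$-th component of each letter; $\Sigma$ is polytraceable if such a $G$ exists. A CA $F$ on $A$ traces $\Sigma$ if $\tau_F=\Sigma$. For $\xi:A'\to A'$ with $\emptyset\ne A'\subseteq A$, the deterministic subshift of $\xi$ is $\mathcal O_\xi=\{(\xi^j(a))_{j\in\mathbb N} : a\in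 A'\}$. Two subshifts $\Sigma,\Gamma$ ultimately coincide if $\sigma^J(\Sigma)=\sigma^J(\Gamma)$ for some $J\in\mathbb N$. Proposition. Let $\Sigma\subseteq A^{\mathbb N}$ be a polytraceable sofic subshift that contains some deterministic subshift $\mathcal O_\xi$, with $\xi:A'\to A'$ and $\emptyset\neq A'\subseteq A$. Then $\Sigma$ ultimately coincides with some subshift $\tilde\Sigma$ which is traceable effectively from a polytracing CA, $\Sigma$ and $\xi$. That is, there is an algorithm (one computable function, the same for all alphabets and all data) that, given finite representations of a CA $G$ polytracing $\Sigma$, of $\Sigma$ (its alphabet $A$ and a graph of $\Sigma$) and of such a map $\xi$, computes a CA $F$ on $A$ (alphabet, anchor, diameter and table of the local rule) which traces a subshift $\tilde\Sigma$ that ultimately coincides with $\Sigma$. -/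

import Mathlib

open SymbolicDynamics.FullShift

namespace CATrace

/-- A one-dimensional cellular automaton on the alphabet `A`: an anchor `m ∈ ℤ`, a diameter `d > 0`
and a local rule `A ^ d → A`. -/
structure CA (A : Type*) where
  anchor : ℤ
  diam : ℕ
  diam_pos : 0 < diam
  rule : (Fin diam → A) → A

/-- The global function: the new state of cell `i` is the local rule applied to the states of the
cells `i - m, …, i - m + d - 1`. -/
def CA.step {A : Type*} (F : CA A) (x : ℤ → A) : ℤ → A :=
  fun i => F.rule fun j => x (i - F.anchor + (j : ℕ))

/-- The trace of a cellular automaton: the sequences of states taken by the cell `0`, over all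
initial configurations. -/
def CA.trace {A : Type*} (F : CA A) : Set (ℕ → A) :=
  {z | ∃ x : ℤ → A, ∀ j, z j = F.step^[j] x 0}

/-- The polytrace of a cellular automaton whose alphabet `B` consists of words of length `k`
over `A`: the union of the `k` projections of its trace. -/
def CA.polytrace {A : Type*} {k : ℕ} {B : Set (Fin k → A)} (G : CA B) : Set (ℕ → A) :=
  ⋃ q : Fin k, (fun (z : ℕ → B) (j : ℕ) => (z j : Fin k → A) q) '' G.trace

/-- `G` polytraces the onesided subshift `S`: it has anchor `0` and diameter `2`, and its polytrace
is `S`. -/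
def CA.Polytraces {A : Type*} [TopologicalSpace A] {k : ℕ} {B : Set (Fin k → A)} (G : CA B)
    (S : Subshift A ℕ) : Prop :=
  G.anchor = 0 ∧ G.diam = 2 ∧ G.polytrace = S.carrier

/-- `F` traces the onesided subshift `S`. -/
def CA.Traces {A : Type*} [TopologicalSpace A] (F : CA A) (S : Subshift A ℕ) : Prop :=
  F.trace = S.carrier

/-- The deterministic subshift of a self-map `ξ` of a subset `A'` of `A`, as a set of infinite
words over `A`. -/
def deterministic {A : Type*} {A' : Set A} (ξ : A' → A') : Set (ℕ → A) :=
  {z | ∃ a : A', ∀ j, z j = (ξ^[j] a : A)}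

/-- Two onesided subshifts ultimately coincide if some power of the shift maps them to the same
set. -/
def UltimatelyCoincide {A : Type*} [TopologicalSpace A] (S T : Subshift A ℕ) : Prop :=
  ∃ J : ℕ, shift J '' S.carrier = shift J '' T.carrier

/-- A finite directed graph with edges labelled in `A`, given by its set of edges
(source, label, target); the vertices are natural numbers. -/
abbrev LabelledGraph (A : Type*) := Finset (ℕ × A × ℕ)

/-- `Γ` is a graph of the onesided subshift `S`: the elements of `S` are exactly the labels of the
infinite paths of `Γ`. A subshift that has such a graph is sofic. -/
def IsGraphOf {A : Type*} [TopologicalSpace A] (Γ : LabelledGraph A) (S : Subshift A ℕ) : Prop :=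
  S.carrier = {z | ∃ v : ℕ → ℕ, ∀ j, (v j, z j, v (j + 1)) ∈ Γ}

/-! ### Finite representations

The letters of an alphabet `X` are named through an injective map `e : X → α`, where `α` is `ℕ`, or
`List ℕ` for an alphabet of words. -/

/-- Finite representations of cellular automata: a list of the letters, the anchor, the diameter
and a table of the local rule. -/
abbrev CACode (α : Type) := List α × ℤ × ℕ × List (List α × α)

/-- `c` represents the cellular automaton `F`, whose letters are named by `e`. -/
def CA.IsCodedBy {X : Type*} {α : Type} (e : X → α) (F : CA X) (c : CACode α) : Prop :=
  (∀ a, a ∈ c.1 ↔ ∃ x, a = e x) ∧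
  c.2.1 = F.anchor ∧
  c.2.2.1 = F.diam ∧
  ∀ w a, (w, a) ∈ c.2.2.2 ↔
    ∃ u : Fin F.diam → X, w = List.ofFn (fun i => e (u i)) ∧ a = e (F.rule u)

/-- The name of a letter of an alphabet `B ⊆ A ^ k`: the list of the names of its `k` letters. -/
def wordName {A : Type*} (e : A → ℕ) {k : ℕ} {B : Set (Fin k → A)} (b : B) : List ℕ :=
  List.ofFn fun i => e (b.1 i)

/-- Finite representations of sofic subshifts: a list of the letters of the alphabet and a list of
the edges of a graph. -/
abbrev SoficCode := List ℕ × List (ℕ × ℕ × ℕ)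

/-- `c` represents the sofic subshift with graph `Γ` on the alphabet `A` named by `e`. -/
def IsSoficCode {A : Type*} (e : A → ℕ) (Γ : LabelledGraph A) (c : SoficCode) : Prop :=
  (∀ n, n ∈ c.1 ↔ ∃ a, n = e a) ∧
  ∀ p n q, (p, n, q) ∈ c.2 ↔ ∃ a, (p, a, q) ∈ Γ ∧ n = e a

/-- Finite representations of self-maps of sub-alphabets: a list of pairs (argument, value). -/
abbrev MapCode := List (ℕ × ℕ)

/-- `c` represents the self-map `ξ` of the sub-alphabet `A'`. -/
def IsMapCode {A : Type*} (e : A → ℕ) {A' : Set A} (ξ : A' → A') (c : MapCode) : Prop :=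
  ∀ n m, (n, m) ∈ c ↔ ∃ a : A', n = e a ∧ m = e (ξ a)

end CATrace

namespace CATrace

/-! ### Primitive recursive predicates -/

section Primrec

variable {α β : Type} [Primcodable α] [Primcodable β]

theorem primrecPred_exists_mem {p : α → β → Prop} {l : α → List β}
    (hp : PrimrecPred fun x : α × β => p x.1 x.2) (hl : Primrec l) :
    PrimrecPred fun a => ∃ b ∈ l a, p a b :=
  (PrimrecRel.exists_mem_list (R := fun b a => p a b)
    (hp.comp (Primrec.pair Primrec.snd Primrec.fst))).comp hl Primrec.id

theorem primrecPred_forall_mem {p : α → β → Prop} {l : α → List β}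
    (hp : PrimrecPred fun x : α × β => p x.1 x.2) (hl : Primrec l) :
    PrimrecPred fun a => ∀ b ∈ l a, p a b :=
  (PrimrecRel.forall_mem_list (R := fun b a => p a b)
    (hp.comp (Primrec.pair Primrec.snd Primrec.fst))).comp hl Primrec.id

theorem primrecPred_exists_lt {p : α → ℕ → Prop} {f : α → ℕ}
    (hp : PrimrecPred fun x : α × ℕ => p x.1 x.2) (hf : Primrec f) :
    PrimrecPred fun a => ∃ b < f a, p a b :=
  (primrecPred_exists_mem hp (Primrec.list_range.comp hf)).of_eq fun a => by simp

theorem primrecPred_forall_lt {p : α → ℕ → Prop} {f : α → ℕ}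
    (hp : PrimrecPred fun x : α × ℕ => p x.1 x.2) (hf : Primrec f) :
    PrimrecPred fun a => ∀ b < f a, p a b :=
  (primrecPred_forall_mem hp (Primrec.list_range.comp hf)).of_eq fun a => by simp

theorem primrecPred_eq {γ : Type} [Primcodable γ] {f g : α → γ} (hf : Primrec f) (hg : Primrec g) :
    PrimrecPred fun a => f a = g a :=
  Primrec.eq.comp hf hg

theorem primrecPred_mem {f : α → β} {l : α → List β} (hf : Primrec f) (hl : Primrec l) :
    PrimrecPred fun a => f a ∈ l a :=
  (primrecPred_exists_mem (p := fun a b => f a = b)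
    (primrecPred_eq (hf.comp Primrec.fst) Primrec.snd) hl).of_eq fun a => by simp

open Classical in
theorem primrec_filter {p : α → β → Prop} {l : α → List β}
    (hp : PrimrecPred fun x : α × β => p x.1 x.2) (hl : Primrec l) :
    Primrec fun a => (l a).filter fun b => p a b :=
  (PrimrecRel.listFilter (R := fun b a => p a b)
    (hp.comp (Primrec.pair Primrec.snd Primrec.fst))).comp hl Primrec.id

open Classical in
theorem primrec_ite {γ : Type} [Primcodable γ] {p : α → Prop} {f g : α → γ}
    (hp : PrimrecPred p) (hf : Primrec f) (hg : Primrec g) :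
    Primrec fun a => if p a then f a else g a :=
  Primrec.ite hp hf hg

theorem primrec_add {f g : α → ℕ} (hf : Primrec f) (hg : Primrec g) :
    Primrec fun a => f a + g a := Primrec.nat_add.comp hf hg

theorem primrec_sub {f g : α → ℕ} (hf : Primrec f) (hg : Primrec g) :
    Primrec fun a => f a - g a := Primrec.nat_sub.comp hf hg

theorem primrec_mul {f g : α → ℕ} (hf : Primrec f) (hg : Primrec g) :
    Primrec fun a => f a * g a := Primrec.nat_mul.comp hf hg

theorem primrec_getD {f : α → List β} {g : α → ℕ} (d : β) (hf : Primrec f) (hg : Primrec g) :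
    Primrec fun a => (f a).getD (g a) d := (Primrec.list_getD d).comp hf hg

end Primrec

/-! ### The local relation of the simulating automaton -/

/-- The word of length `k` read in `u` at position `s`. -/
def factor (u : ℕ → ℕ) (s k : ℕ) : List ℕ := (List.range k).map fun j => u (s + j)

/-- In the window `u`, a content zone of length `k`, preceded and followed by a border of length
`D`, starts at position `s` and holds a word of `Bl`. The predicate `border` reads the window from
`lam` cells before the border on. -/
def ValidAt (border : (ℕ → ℕ) → Prop) (Bl : List (List ℕ)) (k D lam : ℕ) (u : ℕ → ℕ) (s : ℕ) :
    Prop :=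
  border (fun j => u (s - D - lam + j)) ∧ border (fun j => u (s + k - lam + j)) ∧
    factor u s k ∈ Bl

/-- The cell at position `rho` of the window `u` takes the letter `n`: in content zones the table
`gt` applies, elsewhere the relation `Hr` does. -/
def LocalRel (border : (ℕ → ℕ) → Prop) (Bl : List (List ℕ)) (gt : List (List (List ℕ) × List ℕ))
    (k D lam rho : ℕ) (Hr : (ℕ → ℕ) → ℕ → Prop) (u : ℕ → ℕ) (n : ℕ) : Prop :=
  (∃ q < k, ValidAt border Bl k D lam u (rho - q) ∧ ∃ w ∈ gt, n = w.2.getD q 0 ∧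
    ((ValidAt border Bl k D lam u (rho - q + k + D) ∧
        w.1 = [factor u (rho - q) k, factor u (rho - q + k + D) k]) ∨
      (¬ ValidAt border Bl k D lam u (rho - q + k + D) ∧
        w.1 = [factor u (rho - q) k, factor u (rho - q) k]))) ∨
  ((∀ q < k, ¬ ValidAt border Bl k D lam u (rho - q)) ∧ Hr u n)

/-- A border word for a letter map without fixed points. -/
def RotBorder (η : ℕ → ℕ) (k : ℕ) (v : ℕ → ℕ) : Prop :=
  (∀ j < k + 2, v j = v 0) ∧ v (k + 2) = η (v 0)

/-- The letters of the core of a border in phase `t`, for a periodic word `z`. -/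
def core (z : ℕ → ℕ) (m t j : ℕ) : ℕ := z (t + j + j / m)

/-- A core of length `m * p` occurs at position `o`. -/
def CoreAt (z : ℕ → ℕ) (p m : ℕ) (v : ℕ → ℕ) (o : ℕ) : Prop :=
  ∃ t < p, ∀ j < m * p, v (o + j) = core z m t j

/-- A core at position `2 * m * p`, padded with letters `a`, with no other core nearby. -/
def PadBorder (z : ℕ → ℕ) (a p m : ℕ) (v : ℕ → ℕ) : Prop :=
  CoreAt z p m v (2 * (m * p)) ∧
  (∀ j < m * p, v (m * p + j) = a ∧ v (3 * (m * p) + j) = a) ∧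
  ∀ o < 4 * (m * p), o = 0 ∨ o = 2 * (m * p) ∨ ¬ CoreAt z p m v o

/-- The letter taken by the cell at position `rho` outside of content zones: the cores of borders
go to their next phase, and the other cells take the letter `a`. -/
def PadRel (z : ℕ → ℕ) (a p m rho : ℕ) (u : ℕ → ℕ) (n : ℕ) : Prop :=
  (∃ j < m * p, PadBorder z a p m (fun i => u (rho - j - 2 * (m * p) + i)) ∧
    ∃ t < p, (∀ i < m * p, u (rho - j + i) = core z m t i) ∧ n = core z m (t + 1) j) ∨
  ((∀ j < m * p, ¬ PadBorder z a p m (fun i => u (rho - j - 2 * (m * p) + i))) ∧ n = a)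

section Primrec

variable {α γ : Type} [Primcodable α] [Primcodable γ]

theorem primrecPred_validAt {border : α → (ℕ → ℕ) → Prop} {Bl : α → List (List ℕ)}
    {k D lam : α → ℕ}
    (hb : PrimrecPred fun x : (α × List ℕ) × ℕ => border x.1.1 fun j => x.1.2.getD (x.2 + j) 0)
    (hB : Primrec Bl) (hk : Primrec k) (hD : Primrec D) (hl : Primrec lam) :
    PrimrecPred fun x : (α × List ℕ) × ℕ => ValidAt (border x.1.1) (Bl x.1.1) (k x.1.1) (D x.1.1)
      (lam x.1.1) (fun j => x.1.2.getD j 0) x.2 := by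
  have h1 : Primrec fun x : (α × List ℕ) × ℕ => x.1.1 := Primrec.fst.comp Primrec.fst
  have h2 : Primrec fun x : (α × List ℕ) × ℕ => x.2 - D x.1.1 - lam x.1.1 :=
    primrec_sub (primrec_sub Primrec.snd (hD.comp h1)) (hl.comp h1)
  have h3 : Primrec fun x : (α × List ℕ) × ℕ => x.2 + k x.1.1 - lam x.1.1 :=
    primrec_sub (primrec_add Primrec.snd (hk.comp h1)) (hl.comp h1)
  refine PrimrecPred.and ?_ (PrimrecPred.and ?_ ?_)
  · exact hb.comp (Primrec.pair Primrec.fst h2)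
  · exact hb.comp (Primrec.pair Primrec.fst h3)
  · refine primrecPred_mem (Primrec.list_map (Primrec.list_range.comp (hk.comp h1)) ?_)
      (hB.comp h1)
    exact primrec_getD 0 (Primrec.snd.comp (Primrec.fst.comp Primrec.fst))
      (primrec_add (Primrec.snd.comp Primrec.fst) Primrec.snd)

theorem primrec_factor {u : α → List ℕ} {s k : α → ℕ} (hu : Primrec u) (hs : Primrec s)
    (hk : Primrec k) : Primrec fun x => factor (fun j => (u x).getD j 0) (s x) (k x) := by
  refine Primrec.list_map (Primrec.list_range.comp hk) ?_
  exact primrec_getD 0 (hu.comp Primrec.fst) (primrec_add (hs.comp Primrec.fst) Primrec.snd)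

theorem primrecPred_localRel {border : α → (ℕ → ℕ) → Prop} {Bl : α → List (List ℕ)}
    {gt : α → List (List (List ℕ) × List ℕ)}
    {k D lam rho : α → ℕ} {Hr : α → (ℕ → ℕ) → ℕ → Prop}
    (hb : PrimrecPred fun x : (α × List ℕ) × ℕ => border x.1.1 fun j => x.1.2.getD (x.2 + j) 0)
    (hB : Primrec Bl) (hg : Primrec gt) (hk : Primrec k) (hD : Primrec D) (hl : Primrec lam)
    (hr : Primrec rho)
    (hH : PrimrecPred fun x : (α × List ℕ) × ℕ => Hr x.1.1 (fun j => x.1.2.getD j 0) x.2) :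
    PrimrecPred fun x : (α × List ℕ) × ℕ => LocalRel (border x.1.1) (Bl x.1.1) (gt x.1.1)
      (k x.1.1) (D x.1.1) (lam x.1.1) (rho x.1.1) (Hr x.1.1) (fun j => x.1.2.getD j 0) x.2 := by
  have hV := primrecPred_validAt hb hB hk hD hl
  have e1 : Primrec fun x : ((α × List ℕ) × ℕ) × ℕ => x.1.1 := Primrec.fst.comp Primrec.fst
  have s1 : Primrec fun x : ((α × List ℕ) × ℕ) × ℕ => rho x.1.1.1 - x.2 :=
    primrec_sub (hr.comp (Primrec.fst.comp e1)) Primrec.snd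
  have V1 := hV.comp (Primrec.pair e1 s1)
  have e2 : Primrec fun x : (((α × List ℕ) × ℕ) × ℕ) × (List (List ℕ) × List ℕ) => x.1.1.1 :=
    Primrec.fst.comp (Primrec.fst.comp Primrec.fst)
  have e3 : Primrec fun x : (((α × List ℕ) × ℕ) × ℕ) × (List (List ℕ) × List ℕ) => x.1.1.1.1 :=
    Primrec.fst.comp e2
  have u2 : Primrec fun x : (((α × List ℕ) × ℕ) × ℕ) × (List (List ℕ) × List ℕ) => x.1.1.1.2 :=
    Primrec.snd.comp e2
  have s2 := s1.comp (Primrec.fst (α := ((α × List ℕ) × ℕ) × ℕ) (β := List (List ℕ) × List ℕ))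
  have s3 := primrec_add (primrec_add s2 (hk.comp e3)) (hD.comp e3)
  have V2 := hV.comp (Primrec.pair e2 s3)
  have w1 : Primrec fun x : (((α × List ℕ) × ℕ) × ℕ) × (List (List ℕ) × List ℕ) => x.2.1 :=
    Primrec.fst.comp Primrec.snd
  have f1 := primrec_factor u2 s2 (hk.comp e3)
  have f2 := primrec_factor u2 s3 (hk.comp e3)
  have pr : ∀ {f g : (((α × List ℕ) × ℕ) × ℕ) × (List (List ℕ) × List ℕ) → List ℕ},
      Primrec f → Primrec g → Primrec fun x => [f x, g x] := fun hf hg =>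
    Primrec.list_cons.comp hf (Primrec.list_cons.comp hg (Primrec.const []))
  refine PrimrecPred.or ?_ (PrimrecPred.and ?_ hH)
  · refine primrecPred_exists_lt (PrimrecPred.and V1 ?_) (hk.comp (Primrec.fst.comp Primrec.fst))
    refine primrecPred_exists_mem ?_ (hg.comp (Primrec.fst.comp e1))
    refine PrimrecPred.and ?_ (PrimrecPred.or (PrimrecPred.and V2 ?_) (PrimrecPred.and V2.not ?_))
    · exact primrecPred_eq (Primrec.snd.comp (Primrec.fst.comp Primrec.fst))
        (primrec_getD 0 (Primrec.snd.comp Primrec.snd) (Primrec.snd.comp Primrec.fst))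
    · exact primrecPred_eq w1 (pr f1 f2)
    · exact primrecPred_eq w1 (pr f1 f1)
  · exact primrecPred_forall_lt V1.not (hk.comp (Primrec.fst.comp Primrec.fst))

theorem primrecPred_rotBorder {η : α → ℕ → ℕ} {k : α → ℕ} (hη : Primrec₂ η) (hk : Primrec k) :
    PrimrecPred fun x : (α × List ℕ) × ℕ =>
      RotBorder (η x.1.1) (k x.1.1) fun j => x.1.2.getD (x.2 + j) 0 := by
  have h1 : Primrec fun x : (α × List ℕ) × ℕ => x.1.1 := Primrec.fst.comp Primrec.fst
  have g0 : Primrec fun x : (α × List ℕ) × ℕ => x.1.2.getD (x.2 + 0) 0 :=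
    primrec_getD 0 (Primrec.snd.comp Primrec.fst) (primrec_add Primrec.snd (Primrec.const 0))
  have hk2 := primrec_add (hk.comp h1) (Primrec.const 2)
  refine PrimrecPred.and ?_ ?_
  · refine primrecPred_forall_lt (primrecPred_eq ?_ (g0.comp Primrec.fst)) hk2
    exact primrec_getD 0 (Primrec.snd.comp (Primrec.fst.comp Primrec.fst))
      (primrec_add (Primrec.snd.comp Primrec.fst) Primrec.snd)
  · refine primrecPred_eq ?_ (hη.comp h1 g0)
    exact primrec_getD 0 (Primrec.snd.comp Primrec.fst) (primrec_add Primrec.snd hk2)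

variable {z : α → ℕ → ℕ} {a p m rho : α → ℕ}

theorem primrec_core (hz : Primrec₂ z) {x : γ → α} {m t j : γ → ℕ} (hx : Primrec x)
    (hm : Primrec m) (ht : Primrec t) (hj : Primrec j) :
    Primrec fun y => core (z (x y)) (m y) (t y) (j y) :=
  hz.comp hx (primrec_add (primrec_add ht hj) (Primrec.nat_div.comp hj hm))

theorem primrecPred_coreAt (hz : Primrec₂ z) (hp : Primrec p) (hm : Primrec m) :
    PrimrecPred fun x : ((α × List ℕ) × ℕ) × ℕ =>
      CoreAt (z x.1.1.1) (p x.1.1.1) (m x.1.1.1) (fun j => x.1.1.2.getD (x.1.2 + j) 0) x.2 := by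
  have h1 : Primrec fun x : ((α × List ℕ) × ℕ) × ℕ => x.1.1.1 :=
    Primrec.fst.comp (Primrec.fst.comp Primrec.fst)
  have h2 : Primrec fun x : (((α × List ℕ) × ℕ) × ℕ) × ℕ => x.1.1.1.1 := h1.comp Primrec.fst
  have h3 : Primrec fun x : ((((α × List ℕ) × ℕ) × ℕ) × ℕ) × ℕ => x.1.1.1.1.1 :=
    h2.comp Primrec.fst
  refine primrecPred_exists_lt (primrecPred_forall_lt (primrecPred_eq ?_ ?_) 
    (primrec_mul (hm.comp h2) (hp.comp h2))) (hp.comp h1)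
  · refine primrec_getD 0 (Primrec.snd.comp (Primrec.fst.comp (Primrec.fst.comp (Primrec.fst.comp
      Primrec.fst)))) (primrec_add (Primrec.snd.comp (Primrec.fst.comp (Primrec.fst.comp
      Primrec.fst))) (primrec_add (Primrec.snd.comp (Primrec.fst.comp
      Primrec.fst)) Primrec.snd))
  · exact primrec_core hz h3 (hm.comp h3) (Primrec.snd.comp Primrec.fst) Primrec.snd

theorem primrecPred_padBorder (hz : Primrec₂ z) (ha : Primrec a) (hp : Primrec p)
    (hm : Primrec m) : PrimrecPred fun x : (α × List ℕ) × ℕ =>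
      PadBorder (z x.1.1) (a x.1.1) (p x.1.1) (m x.1.1) fun j => x.1.2.getD (x.2 + j) 0 := by
  have h1 : Primrec fun x : (α × List ℕ) × ℕ => x.1.1 := Primrec.fst.comp Primrec.fst
  have h2 : Primrec fun x : ((α × List ℕ) × ℕ) × ℕ => x.1.1.1 := h1.comp Primrec.fst
  have hM : Primrec fun y => m y * p y := primrec_mul hm hp
  have hc : ∀ c, Primrec fun y => c * (m y * p y) := fun c => primrec_mul (Primrec.const c) hM
  have hC := primrecPred_coreAt hz hp hm
  refine PrimrecPred.and ?_ (PrimrecPred.and ?_ ?_)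
  · exact hC.comp (Primrec.pair Primrec.id ((hc 2).comp h1))
  · have hu : Primrec fun x : ((α × List ℕ) × ℕ) × ℕ => x.1.1.2 :=
      Primrec.snd.comp (Primrec.fst.comp Primrec.fst)
    refine primrecPred_forall_lt (PrimrecPred.and (primrecPred_eq ?_ (ha.comp h2))
      (primrecPred_eq ?_ (ha.comp h2))) (hM.comp h1)
    · exact primrec_getD 0 hu (primrec_add (Primrec.snd.comp Primrec.fst)
        (primrec_add (hM.comp h2) Primrec.snd))
    · exact primrec_getD 0 hu (primrec_add (Primrec.snd.comp Primrec.fst)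
        (primrec_add ((hc 3).comp h2) Primrec.snd))
  · exact primrecPred_forall_lt (PrimrecPred.or (primrecPred_eq Primrec.snd (Primrec.const 0))
      (PrimrecPred.or (primrecPred_eq Primrec.snd ((hc 2).comp h2)) hC.not)) ((hc 4).comp h1)

theorem primrecPred_padRel (hz : Primrec₂ z) (ha : Primrec a) (hp : Primrec p)
    (hm : Primrec m) (hr : Primrec rho) : PrimrecPred fun x : (α × List ℕ) × ℕ =>
      PadRel (z x.1.1) (a x.1.1) (p x.1.1) (m x.1.1) (rho x.1.1) (fun j => x.1.2.getD j 0) x.2 := by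
  have h1 : Primrec fun x : (α × List ℕ) × ℕ => x.1.1 := Primrec.fst.comp Primrec.fst
  have h2 : Primrec fun x : ((α × List ℕ) × ℕ) × ℕ => x.1.1.1 := h1.comp Primrec.fst
  have h3 : Primrec fun x : (((α × List ℕ) × ℕ) × ℕ) × ℕ => x.1.1.1.1 := h2.comp Primrec.fst
  have h4 : Primrec fun x : ((((α × List ℕ) × ℕ) × ℕ) × ℕ) × ℕ => x.1.1.1.1.1 :=
    h3.comp Primrec.fst
  have hM : Primrec fun y => m y * p y := primrec_mul hm hp
  have hB := (primrecPred_padBorder hz ha hp hm).comp (Primrec.pair (Primrec.fst.comp Primrec.fst)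
    (primrec_sub (primrec_sub (hr.comp h2) Primrec.snd)
      (primrec_mul (Primrec.const 2) (hM.comp h2))))
  refine PrimrecPred.or ?_ (PrimrecPred.and (primrecPred_forall_lt hB.not (hM.comp h1))
    (primrecPred_eq Primrec.snd (ha.comp h1)))
  refine primrecPred_exists_lt (PrimrecPred.and hB ?_) (hM.comp h1)
  refine primrecPred_exists_lt (PrimrecPred.and ?_ ?_) (hp.comp h2)
  · refine primrecPred_forall_lt (primrecPred_eq ?_ ?_) (hM.comp h3)
    · exact primrec_getD 0 (Primrec.snd.comp (Primrec.fst.comp (Primrec.fst.comp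
        (Primrec.fst.comp Primrec.fst)))) (primrec_add (primrec_sub (hr.comp h4)
        (Primrec.snd.comp (Primrec.fst.comp Primrec.fst))) Primrec.snd)
    · exact primrec_core hz h4 (hm.comp h4) (Primrec.snd.comp Primrec.fst) Primrec.snd
  · exact primrecPred_eq (Primrec.snd.comp (Primrec.fst.comp Primrec.fst))
      (primrec_core hz h3 (hm.comp h3) (primrec_add Primrec.snd (Primrec.const 1))
        (Primrec.snd.comp Primrec.fst))

end Primrec

/-! ### The algorithm -/

/-- The value at `n` of the map given by the pairs in `xi`. -/
def look (xi : MapCode) (n : ℕ) : ℕ := (xi.lookup n).getD 0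

/-- A periodic point of a nonempty self-map. -/
def cyclePoint (xi : MapCode) : ℕ := (look xi)^[xi.length] xi.headI.1

/-- The orbit of `cyclePoint xi`. -/
def cycleList (xi : MapCode) : List ℕ :=
  (List.range (xi.length + 1)).map fun t => (look xi)^[t] (cyclePoint xi)

open Classical in
/-- The map that extends the permutation of the cycle of `cyclePoint xi` by a constant. -/
noncomputable def rotation (xi : MapCode) (c : ℕ) : ℕ :=
  if c ∈ cycleList xi then look xi c else cyclePoint xi

/-- The words of length `n` over the list `l`. -/
def allWords {α : Type} (l : List α) (n : ℕ) : List (List α) :=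
  (fun W => W.flatMap fun w => l.map fun a => a :: w)^[n] [[]]

theorem mem_allWords {α : Type} {l : List α} {n : ℕ} {w : List α} :
    w ∈ allWords l n ↔ w.length = n ∧ ∀ a ∈ w, a ∈ l := by
  induction n generalizing w with
  | zero =>
    simp only [allWords, Function.iterate_zero, id, List.mem_singleton]
    constructor
    · rintro rfl; simp
    · exact fun h => List.length_eq_zero_iff.1 h.1
  | succ n ih =>
    unfold allWords at ih ⊢
    rw [Function.iterate_succ_apply']
    simp only [List.mem_flatMap, List.mem_map, ih]
    constructor
    · rintro ⟨v, ⟨h1, h2⟩, a, ha, rfl⟩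
      exact ⟨by simp [h1], by simpa using ⟨ha, h2⟩⟩
    · rintro ⟨h1, h2⟩
      cases w with
      | nil => simp at h1
      | cons a v =>
        simp only [List.mem_cons, forall_eq_or_imp] at h2
        exact ⟨v, ⟨by simpa using h1, h2.2⟩, a, h2.1, rfl⟩

/-- `w` is a closed walk which has a label different from `a`. -/
def IsClosedWalk (a : ℕ) (w : List (ℕ × ℕ × ℕ)) : Prop :=
  (∀ i < w.length, (w.getD i default).2.2 = (w.getD ((i + 1) % w.length) default).1) ∧
    ∃ i < w.length, (w.getD i default).2.1 ≠ a

open Classical in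
/-- A closed walk in the graph `E` with a label different from `a`, or the empty list. -/
noncomputable def findWalk (E : List (ℕ × ℕ × ℕ)) (a : ℕ) : List (ℕ × ℕ × ℕ) :=
  (((List.range (E.length + 1)).flatMap fun n => allWords E n).filter
    fun w => IsClosedWalk a w).headI

/-- The periodic sequence of the labels of a closed walk. -/
def walkLabel (w : List (ℕ × ℕ × ℕ)) (j : ℕ) : ℕ := (w.getD (j % w.length) default).2.1

/-- The input of the algorithm. -/
abbrev Input := CACode (List ℕ) × SoficCode × MapCode

namespace Input

variable (I : Input)

/-- The length of the letters of the polytracing automaton. -/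
def width : ℕ := I.1.1.headI.length

/-- A periodic letter. -/
def letter : ℕ := cyclePoint I.2.2

/-- The closed walk used for borders. -/
noncomputable def walk : List (ℕ × ℕ × ℕ) := findWalk I.2.1.2 I.letter

/-- The length of the blocks of a core. -/
noncomputable def block : ℕ := 2 * I.walk.length * (I.width + 1)

/-- The length of a core. -/
noncomputable def coreLength : ℕ := I.block * I.walk.length

/-- The radius of the computed automaton. -/
noncomputable def radius : ℕ := 4 * I.width + 10 + 20 * I.coreLength

/-- The local relation of the computed automaton. -/
def Rel (u : ℕ → ℕ) (n : ℕ) : Prop :=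
  (look I.2.2 I.letter ≠ I.letter ∧
    LocalRel (RotBorder (rotation I.2.2) I.width) I.1.1 I.1.2.2.2 I.width (I.width + 3) 0 I.radius
      (fun u n => n = rotation I.2.2 (u I.radius)) u n) ∨
  (look I.2.2 I.letter = I.letter ∧ I.walk ≠ [] ∧
    LocalRel (PadBorder (walkLabel I.walk) I.letter I.walk.length I.block) I.1.1 I.1.2.2.2 I.width
      (3 * I.coreLength) I.coreLength I.radius
      (PadRel (walkLabel I.walk) I.letter I.walk.length I.block I.radius) u n) ∨
  (look I.2.2 I.letter = I.letter ∧ I.walk = [] ∧ n = I.letter)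

open Classical in
/-- The code of the computed automaton. -/
noncomputable def output : CACode ℕ :=
  (I.2.1.1, (I.radius : ℤ), 2 * I.radius + 1,
    ((allWords I.2.1.1 (2 * I.radius + 1)).flatMap fun w => I.2.1.1.map fun n => (w, n)).filter
      fun x => I.Rel (fun j => x.1.getD j 0) x.2)

end Input

section Primrec

theorem primrec_look : Primrec₂ look :=
  Primrec.option_getD.comp (Primrec.listLookup.comp Primrec.snd Primrec.fst) (Primrec.const 0)

theorem primrec_cyclePoint : Primrec cyclePoint :=
  Primrec.nat_iterate Primrec.list_length (Primrec.fst.comp Primrec.list_headI) primrec_look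

theorem primrec_cycleList : Primrec cycleList :=
  Primrec.list_map (Primrec.list_range.comp (primrec_add Primrec.list_length (Primrec.const 1)))
    (Primrec.nat_iterate Primrec.snd (primrec_cyclePoint.comp Primrec.fst)
      (primrec_look.comp (Primrec.fst.comp Primrec.fst) Primrec.snd))

theorem primrec_rotation : Primrec₂ rotation :=
  (primrec_ite (primrecPred_mem Primrec.snd (primrec_cycleList.comp Primrec.fst)) primrec_look
    (primrec_cyclePoint.comp Primrec.fst)).of_eq fun x => by
      simp only [rotation]; congr

theorem primrec_allWords {α : Type} [Primcodable α] : Primrec₂ (allWords (α := α)) := by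
  refine Primrec.nat_iterate Primrec.snd (Primrec.const [[]]) ?_
  refine Primrec.list_flatMap Primrec.snd ?_
  refine Primrec.list_map (Primrec.fst.comp (Primrec.fst.comp Primrec.fst)) ?_
  exact Primrec.list_cons.comp Primrec.snd (Primrec.snd.comp Primrec.fst)

theorem primrecPred_isClosedWalk :
    PrimrecPred fun x : ℕ × List (ℕ × ℕ × ℕ) => IsClosedWalk x.1 x.2 := by
  have h2 : Primrec fun x : (ℕ × List (ℕ × ℕ × ℕ)) × ℕ => x.1.2 := Primrec.snd.comp Primrec.fst
  have hl := Primrec.list_length.comp (Primrec.snd (α := ℕ) (β := List (ℕ × ℕ × ℕ)))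
  refine PrimrecPred.and ?_ ?_
  · refine primrecPred_forall_lt (primrecPred_eq ?_ ?_) hl
    · exact Primrec.snd.comp (Primrec.snd.comp (primrec_getD default h2 Primrec.snd))
    · exact Primrec.fst.comp (primrec_getD default h2 (Primrec.nat_mod.comp
        (primrec_add Primrec.snd (Primrec.const 1)) (Primrec.list_length.comp h2)))
  · refine primrecPred_exists_lt (PrimrecPred.not (primrecPred_eq ?_ ?_)) hl
    · exact Primrec.fst.comp (Primrec.snd.comp (primrec_getD default h2 Primrec.snd))
    · exact Primrec.fst.comp Primrec.fst

theorem primrec_findWalk : Primrec₂ findWalk := by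
  refine Primrec.list_headI.comp (primrec_filter (p := fun (x : List (ℕ × ℕ × ℕ) × ℕ) w =>
    IsClosedWalk x.2 w) ?_ ?_)
  · exact primrecPred_isClosedWalk.comp (Primrec.pair (Primrec.snd.comp Primrec.fst) Primrec.snd)
  · refine Primrec.list_flatMap (Primrec.list_range.comp (primrec_add
      (Primrec.list_length.comp Primrec.fst) (Primrec.const 1))) ?_
    exact primrec_allWords.comp (Primrec.fst.comp Primrec.fst) Primrec.snd

theorem primrec_walkLabel : Primrec₂ walkLabel :=
  Primrec.fst.comp (Primrec.snd.comp (primrec_getD default Primrec.fst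
    (Primrec.nat_mod.comp Primrec.snd (Primrec.list_length.comp Primrec.fst))))

theorem primrec_natCast_int : Primrec fun n : ℕ => (n : ℤ) :=
  Primrec.encode_iff.1 ((primrec_mul (Primrec.const 2) Primrec.id).of_eq fun n => by rfl)

namespace Input

theorem primrec_width : Primrec width :=
  Primrec.list_length.comp (Primrec.list_headI.comp (Primrec.fst.comp Primrec.fst))

theorem primrec_letter : Primrec letter :=
  primrec_cyclePoint.comp (Primrec.snd.comp Primrec.snd)

theorem primrec_walk : Primrec walk :=
  primrec_findWalk.comp (Primrec.snd.comp (Primrec.fst.comp Primrec.snd)) primrec_letter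

theorem primrec_block : Primrec block :=
  primrec_mul (primrec_mul (Primrec.const 2) (Primrec.list_length.comp primrec_walk))
    (primrec_add primrec_width (Primrec.const 1))

theorem primrec_coreLength : Primrec coreLength :=
  primrec_mul primrec_block (Primrec.list_length.comp primrec_walk)

theorem primrec_radius : Primrec radius :=
  primrec_add (primrec_add (primrec_mul (Primrec.const 4) primrec_width) (Primrec.const 10))
    (primrec_mul (Primrec.const 20) primrec_coreLength)

theorem primrecPred_rel : PrimrecPred fun x : (Input × List ℕ) × ℕ =>
    x.1.1.Rel (fun j => x.1.2.getD j 0) x.2 := by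
  have h1 : Primrec fun x : (Input × List ℕ) × ℕ => x.1.1 := Primrec.fst.comp Primrec.fst
  have hxi : Primrec fun I : Input => I.2.2 := Primrec.snd.comp Primrec.snd
  have hB : Primrec fun I : Input => I.1.1 := Primrec.fst.comp Primrec.fst
  have hg : Primrec fun I : Input => I.1.2.2.2 :=
    Primrec.snd.comp (Primrec.snd.comp (Primrec.snd.comp Primrec.fst))
  have hrot : Primrec₂ fun I : Input => rotation I.2.2 :=
    primrec_rotation.comp (hxi.comp Primrec.fst) Primrec.snd
  have hz : Primrec₂ fun I : Input => walkLabel I.walk :=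
    primrec_walkLabel.comp (primrec_walk.comp Primrec.fst) Primrec.snd
  have hfix : PrimrecPred fun x : (Input × List ℕ) × ℕ =>
      look x.1.1.2.2 x.1.1.letter = x.1.1.letter :=
    primrecPred_eq (primrec_look.comp (hxi.comp h1) (primrec_letter.comp h1))
      (primrec_letter.comp h1)
  have hw : PrimrecPred fun x : (Input × List ℕ) × ℕ => x.1.1.walk = [] :=
    primrecPred_eq (primrec_walk.comp h1) (Primrec.const [])
  have hl := Primrec.list_length.comp primrec_walk
  have hD : Primrec fun I : Input => I.width + 3 :=
    primrec_add primrec_width (Primrec.const 3)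
  have hD' : Primrec fun I : Input => 3 * I.coreLength :=
    primrec_mul (Primrec.const 3) primrec_coreLength
  have hb := primrecPred_rotBorder (η := fun I : Input => rotation I.2.2) hrot primrec_width
  have hr : PrimrecPred fun x : (Input × List ℕ) × ℕ =>
      x.2 = rotation x.1.1.2.2 (x.1.2.getD x.1.1.radius 0) :=
    primrecPred_eq Primrec.snd (hrot.comp h1
      (primrec_getD 0 (Primrec.snd.comp Primrec.fst) (primrec_radius.comp h1)))
  have hl0 : Primrec fun _ : Input => 0 := Primrec.const 0
  have hA := primrecPred_localRel
    (border := fun I : Input => RotBorder (rotation I.2.2) I.width) (Hr := fun I u n => n = rotation I.2.2 (u I.radius))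
    hb hB hg primrec_width hD hl0 primrec_radius hr
  have hb' := primrecPred_padBorder hz primrec_letter hl primrec_block
  have hr' := primrecPred_padRel hz primrec_letter hl primrec_block primrec_radius
  have hA' := primrecPred_localRel
    (border := fun I : Input => PadBorder (walkLabel I.walk) I.letter I.walk.length I.block)
    (Hr := fun I => PadRel (walkLabel I.walk) I.letter I.walk.length I.block I.radius)
    hb' hB hg primrec_width hD' primrec_coreLength primrec_radius hr'
  have hc : PrimrecPred fun x : (Input × List ℕ) × ℕ => x.2 = x.1.1.letter :=
    primrecPred_eq Primrec.snd (primrec_letter.comp h1)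
  exact (hfix.not.and hA).or ((hfix.and (hw.not.and hA')).or (hfix.and (hw.and hc)))

theorem primrec_output : Primrec output := by
  have halph : Primrec fun I : Input => I.2.1.1 :=
    Primrec.fst.comp (Primrec.fst.comp Primrec.snd)
  have hd : Primrec fun I : Input => 2 * I.radius + 1 :=
    primrec_add (primrec_mul (Primrec.const 2) primrec_radius) (Primrec.const 1)
  refine Primrec.pair halph (Primrec.pair (primrec_natCast_int.comp primrec_radius)
    (Primrec.pair hd (primrec_filter (p := fun (I : Input) (x : List ℕ × ℕ) =>
      I.Rel (fun j => x.1.getD j 0) x.2) ?_ ?_)))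
  · exact primrecPred_rel.comp (Primrec.pair (Primrec.pair Primrec.fst
      (Primrec.fst.comp Primrec.snd)) (Primrec.snd.comp Primrec.snd))
  · refine Primrec.list_flatMap (primrec_allWords.comp halph hd) ?_
    refine Primrec.list_map (halph.comp Primrec.fst) ?_
    exact Primrec.pair (Primrec.snd.comp Primrec.fst) Primrec.snd

theorem computable_output : Computable output := primrec_output.to_comp

end Input

end Primrec

/-! ### Nilpotency of onesided automata with few non-quiescent states -/

section Nilpotent

variable {B : Type*}

/-- The onesided automaton of diameter `2` with local rule `g`. -/
def push (g : B → B → B) (y : ℕ → B) : ℕ → B := fun n => g (y n) (y (n + 1))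

variable {g : B → B → B}

theorem push_iterate_congr {y y' : ℕ → B} {n t : ℕ} (h : ∀ j, n ≤ j → j ≤ n + t → y j = y' j) :
    (push g)^[t] y n = (push g)^[t] y' n := by
  induction t generalizing n with
  | zero => exact h n le_rfl le_rfl
  | succ t ih =>
    rw [Function.iterate_succ_apply', Function.iterate_succ_apply']
    unfold push at ih ⊢
    rw [ih fun j h1 h2 => h j h1 (by omega), ih fun j h1 h2 => h j (by omega) (by omega)]

theorem push_iterate_shift (y : ℕ → B) (n t : ℕ) :
    (push g)^[t] y n = (push g)^[t] (fun j => y (n + j)) 0 := by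
  induction t generalizing y with
  | zero => rfl
  | succ t ih =>
    rw [Function.iterate_succ_apply, Function.iterate_succ_apply, ih]
    rfl

theorem push_iterate_const {ω : B} (hω : g ω ω = ω) (t : ℕ) :
    (push g)^[t] (fun _ => ω) = fun _ => ω :=
  Function.iterate_fixed (funext fun _ => hω) t

theorem push_iterate_eq_of_forall_eq {ω : B} (hω : g ω ω = ω) {y : ℕ → B} {n t : ℕ}
    (h : ∀ j, n ≤ j → j ≤ n + t → y j = ω) : (push g)^[t] y n = ω := by
  rw [push_iterate_congr (y' := fun _ => ω) h, push_iterate_const hω]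

/-- If some quiescent block stops all signals, then the automaton is nilpotent. -/
theorem nilpotent_of_blocking [Finite B] {ω : B}
    (hfin : ∀ y : ℕ → B, {t | (push g)^[t] y 0 ≠ ω}.Finite) {m : ℕ}
    (hm : ∀ y : ℕ → B, (∀ j < m, y j = ω) → ∀ t, (push g)^[t] y 0 = ω) :
    ∃ T, ∀ y : ℕ → B, ∀ t ≥ T, (push g)^[t] y 0 = ω := by
  let _ : TopologicalSpace B := ⊥
  have : DiscreteTopology B := ⟨rfl⟩
  have hc : Continuous (push g) := continuous_pi fun n => by
    have h1 : Continuous fun x : B × B => g x.1 x.2 := continuous_of_discreteTopology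
    have h2 : Continuous fun y : ℕ → B => (y n, y (n + 1)) :=
      (continuous_apply n).prodMk (continuous_apply (n + 1))
    exact h1.comp h2
  let U : ℕ → Set (ℕ → B) := fun T => {y | ∀ j < m, (push g)^[T] y j = ω}
  have hU : ∀ T, IsOpen (U T) := fun T => by
    have : U T = ⋂ j ∈ Finset.range m, (fun y : ℕ → B => (push g)^[T] y j) ⁻¹' {ω} := by
      ext y; simp [U]
    rw [this]
    exact isOpen_biInter_finset fun j _ => (isOpen_discrete _).preimage
      ((continuous_apply j).comp (hc.iterate T))
  have hcov : Set.univ ⊆ ⋃ T, U T := fun y _ => by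
    have hf : (⋃ j ∈ Finset.range m, {t | (push g)^[t] y j ≠ ω}).Finite :=
      Set.Finite.biUnion (Finset.finite_toSet _) fun j _ => by
        simpa only [push_iterate_shift y j] using hfin fun i => y (j + i)
    obtain ⟨T, hT⟩ := hf.exists_notMem
    refine Set.mem_iUnion.2 ⟨T, fun j hj => ?_⟩
    by_contra h
    exact hT (Set.mem_biUnion (Finset.mem_coe.2 (Finset.mem_range.2 hj)) h)
  obtain ⟨s, hs⟩ := isCompact_univ.elim_finite_subcover U hU hcov
  refine ⟨s.sup id, fun y t ht => ?_⟩
  obtain ⟨T, hTs, hT⟩ := Set.mem_iUnion₂.1 (hs (Set.mem_univ y))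
  have hle : T ≤ t := (Finset.le_sup (f := id) hTs).trans ht
  obtain ⟨r, rfl⟩ := Nat.exists_eq_add_of_le' hle
  rw [Function.iterate_add_apply]
  exact hm _ hT r

/-- If all cells are quiescent but for a bounded number of times, then the automaton is
nilpotent. -/
theorem nilpotent_of_bounded [Finite B] {ω : B} (hω : g ω ω = ω) {C : ℕ}
    (hC : ∀ y : ℕ → B, {t | (push g)^[t] y 0 ≠ ω}.Finite ∧
      {t | (push g)^[t] y 0 ≠ ω}.ncard ≤ C) :
    ∃ T, ∀ y : ℕ → B, ∀ t ≥ T, (push g)^[t] y 0 = ω := by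
  classical
  by_contra hnil
  have hsig : ∀ m, ∃ y : ℕ → B, (∀ j < m, y j = ω) ∧ ∃ t, (push g)^[t] y 0 ≠ ω := by
    intro m
    by_contra! h
    exact hnil (nilpotent_of_blocking (fun y => (hC y).1) h)
  let N : (ℕ → B) → Set ℕ := fun y => {t | (push g)^[t] y 0 ≠ ω}
  obtain ⟨x, hx⟩ : ∃ x, ∀ y, (N y).ncard ≤ (N x).ncard := by
    have hb : BddAbove (Set.range fun y => (N y).ncard) :=
      ⟨C, by rintro _ ⟨y, rfl⟩; exact (hC y).2⟩
    obtain ⟨x, hx⟩ := Nat.sSup_mem ⟨_, Set.mem_range_self fun _ => ω⟩ hb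
    exact ⟨x, fun y => by
      rw [show (N x).ncard = _ from hx]; exact le_csSup hb (Set.mem_range_self y)⟩
  obtain ⟨T, hT⟩ := (hC x).1.bddAbove
  let x' : ℕ → B := fun j => if j ≤ T then x j else ω
  have hdead : ∀ j, T < j → ∀ t, (push g)^[t] x' j = ω := fun j hj t =>
    push_iterate_eq_of_forall_eq hω fun i hi _ => if_neg (by omega)
  have hf : (⋃ j ∈ Finset.range (T + 1), {t | (push g)^[t] x' j ≠ ω}).Finite :=
    Set.Finite.biUnion (Finset.finite_toSet _) fun j _ => by
      simpa only [push_iterate_shift x' j] using (hC fun i => x' (j + i)).1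
  obtain ⟨T₀, hT₀⟩ := hf.bddAbove
  let T' := max T₀ T + 1
  have hx'dead : (push g)^[T'] x' = fun _ => ω := by
    funext j
    rcases lt_or_ge T j with hj | hj
    · exact hdead j hj T'
    · by_contra h
      have := hT₀ (Set.mem_biUnion (Finset.mem_coe.2 (Finset.mem_range.2 (Nat.lt_succ_of_le hj))) h)
      omega
  let m := T + T' + 2
  obtain ⟨y, hy, t₀, ht₀⟩ := hsig m
  have ht₀' : T' < t₀ := by
    by_contra h
    exact ht₀ (push_iterate_eq_of_forall_eq hω fun j _ hj => hy j (by omega))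
  let w : ℕ → B := fun j => if j ≤ T then x j else y j
  have hwx : ∀ j < m, w j = x' j := fun j hj => by
    by_cases h : j ≤ T
    · simp [w, x', h]
    · simp [w, x', h, hy j hj]
  have hwT : (push g)^[T'] w = (push g)^[T'] y := by
    funext j
    rcases lt_or_ge T j with hj | hj
    · exact push_iterate_congr fun i hi _ => if_neg (by omega)
    · rw [push_iterate_congr (y' := x') fun i _ hi => hwx i (by omega), hx'dead]
      exact (push_iterate_eq_of_forall_eq hω fun i _ hi => hy i (by omega)).symm
  have hsub : insert t₀ (N x) ⊆ N w := by
    refine Set.insert_subset ?_ fun t ht => ?_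
    · change (push g)^[t₀] w 0 ≠ ω
      obtain ⟨r, hr⟩ := Nat.exists_eq_add_of_le' ht₀'.le
      rw [hr, Function.iterate_add_apply, hwT, ← Function.iterate_add_apply, ← hr]
      exact ht₀
    · have htT : t ≤ T := hT ht
      change (push g)^[t] w 0 ≠ ω
      rw [push_iterate_congr (y' := x) fun j _ hj => if_pos (by omega)]
      exact ht
  have hnot : t₀ ∉ N x := fun h => by
    have : t₀ ≤ T := hT h
    omega
  have h1 := Set.ncard_le_ncard hsub (hC w).1
  rw [Set.ncard_insert_of_notMem hnot (hC x).1] at h1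
  have := hx w
  omega

end Nilpotent

/-! ### Simulation by content zones between borders -/

/-- The word of length `k` at position `i` of a configuration. -/
def factorZ (X : ℤ → ℕ) (i : ℤ) (k : ℕ) : List ℕ := (List.range k).map fun j => X (i + (j : ℕ))

theorem factorZ_eq_iff {X : ℤ → ℕ} {i : ℤ} {k : ℕ} {w : List ℕ} :
    factorZ X i k = w ↔ w.length = k ∧ ∀ j < k, X (i + (j : ℕ)) = w.getD j 0 := by
  constructor
  · rintro rfl
    refine ⟨by simp [factorZ], fun j hj => ?_⟩
    simp [factorZ, hj]
  · rintro ⟨rfl, h⟩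
    refine List.ext_getElem (by simp [factorZ]) fun j h1 h2 => ?_
    have := h j h2
    simp [factorZ, this, h2]

/-- The part of a configuration to the right of the position `c - rho`. -/
def window (X : ℤ → ℕ) (rho : ℕ) (c : ℤ) : ℕ → ℕ := fun j => X (c - rho + (j : ℕ))

/-- The onesided rule `g` on configurations. -/
def pushZ {B : Type*} (g : B → B → B) (y : ℤ → B) : ℤ → B := fun n => g (y n) (y (n + 1))

/-- The data of a simulation of the rule `rule` on the letters `B`, which are named by words. -/
structure Scheme (B : Type*) where
  /-- recognizes borders in windows that start `lam` cells before the border -/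
  border : (ℕ → ℕ) → Prop
  /-- the length of content zones -/
  k : ℕ
  /-- the length of borders -/
  D : ℕ
  lam : ℕ
  /-- the radius of the local relation -/
  rho : ℕ
  /-- the local relation outside of content zones -/
  outer : (ℕ → ℕ) → ℕ → Prop
  name : B → List ℕ
  rule : B → B → B
  name_injective : Function.Injective name
  length_name : ∀ b, (name b).length = k
  le_rho : k + D + lam ≤ rho

namespace Scheme

variable {B : Type*} (P : Scheme B)

/-- A border starts at position `i`. -/
def Border (X : ℤ → ℕ) (i : ℤ) : Prop := P.border fun j => X (i - P.lam + (j : ℕ))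

/-- A content zone starts at position `i`. -/
def Zone (X : ℤ → ℕ) (i : ℤ) : Prop := P.Border X (i - P.D) ∧ P.Border X (i + P.k)

/-- A content zone with the name of `b` starts at position `i`. -/
def Holds (X : ℤ → ℕ) (i : ℤ) (b : B) : Prop := P.Zone X i ∧ factorZ X i P.k = P.name b

/-- A content zone with the name of some letter starts at position `i`. -/
def Valid (X : ℤ → ℕ) (i : ℤ) : Prop := ∃ b, P.Holds X i b

/-- The distance of consecutive content zones. -/
def gap : ℤ := P.k + P.D

/-- One step of the simulation. -/
structure Step (X Y : ℤ → ℕ) : Prop where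
  holds : ∀ {i b b'}, P.Holds X i b → P.Holds X (i + P.gap) b' →
    factorZ Y i P.k = P.name (P.rule b b')
  holds_last : ∀ {i b}, P.Holds X i b → ¬ P.Valid X (i + P.gap) →
    factorZ Y i P.k = P.name (P.rule b b)
  outer : ∀ c : ℤ, (∀ i : ℤ, i ≤ c → c < i + P.k → ¬ P.Valid X i) → P.outer (window X P.rho c) (Y c)

/-- Distinct content zones are disjoint. -/
def Disjoint : Prop := ∀ (X : ℤ → ℕ) (i i' : ℤ), P.Zone X i → P.Zone X i' → i ≤ i' →
  i' < i + P.k → i = i'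

/-- Content zones persist. -/
def Persistent : Prop := ∀ (X Y : ℤ → ℕ), P.Step X Y → ∀ i, P.Zone X i → P.Zone Y i

variable {P}

theorem Holds.unique {X : ℤ → ℕ} {i : ℤ} {b b' : B} (h : P.Holds X i b) (h' : P.Holds X i b') :
    b = b' := P.name_injective (h.2.symm.trans h'.2)

theorem border_window {X : ℤ → ℕ} {c : ℤ} {s : ℕ} (hs : P.lam ≤ s) :
    P.border (fun j => window X P.rho c (s - P.lam + j)) ↔ P.Border X (c - P.rho + s) := by
  unfold Border window
  have : (fun j : ℕ => X (c - P.rho + ((s - P.lam + j : ℕ) : ℤ))) =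
      fun j : ℕ => X (c - P.rho + s - P.lam + (j : ℕ)) := by
    funext j
    congr 1
    push_cast [hs]
    ring
  rw [this]

theorem factor_window {X : ℤ → ℕ} {c : ℤ} {s k : ℕ} :
    factor (window X P.rho c) s k = factorZ X (c - P.rho + s) k := by
  unfold factor factorZ window
  refine List.map_congr_left fun j _ => ?_
  congr 1
  push_cast
  ring

theorem validAt_window {Bl : List (List ℕ)} (hB : ∀ w, w ∈ Bl ↔ ∃ b, w = P.name b)
    {X : ℤ → ℕ} {c : ℤ} {s : ℕ} (hs : P.D + P.lam ≤ s) :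
    ValidAt P.border Bl P.k P.D P.lam (window X P.rho c) s ↔ P.Valid X (c - P.rho + s) := by
  unfold ValidAt Valid Holds Zone
  rw [border_window (by omega), border_window (by omega), factor_window, hB]
  have e1 : c - (P.rho : ℤ) + ((s - P.D : ℕ) : ℤ) = c - P.rho + s - P.D := by
    push_cast [show P.D ≤ s by omega]; ring
  have e2 : c - (P.rho : ℤ) + ((s + P.k : ℕ) : ℤ) = c - P.rho + s + P.k := by push_cast; ring
  rw [e1, e2]
  constructor
  · rintro ⟨h1, h2, b, h3⟩; exact ⟨b, ⟨h1, h2⟩, h3⟩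
  · rintro ⟨b, ⟨h1, h2⟩, h3⟩; exact ⟨h1, h2, b, h3⟩

/-- The local relation at a cell of a configuration. -/
theorem localRel_window {Bl : List (List ℕ)} {gt : List (List (List ℕ) × List ℕ)}
    (hB : ∀ w, w ∈ Bl ↔ ∃ b, w = P.name b)
    (hg : ∀ w v, (w, v) ∈ gt ↔ ∃ b b', w = [P.name b, P.name b'] ∧ v = P.name (P.rule b b'))
    {X : ℤ → ℕ} {c : ℤ} {n : ℕ} :
    LocalRel P.border Bl gt P.k P.D P.lam P.rho P.outer (window X P.rho c) n ↔
      (∃ q < P.k, ∃ b, P.Holds X (c - q) b ∧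
        ((∃ b', P.Holds X (c - q + P.gap) b' ∧ n = (P.name (P.rule b b')).getD q 0) ∨
          (¬ P.Valid X (c - q + P.gap) ∧ n = (P.name (P.rule b b)).getD q 0))) ∨
      ((∀ q < P.k, ¬ P.Valid X (c - (q : ℕ))) ∧ P.outer (window X P.rho c) n) := by
  have hrho := P.le_rho
  have e1 : ∀ q < P.k, c - (P.rho : ℤ) + ((P.rho - q : ℕ) : ℤ) = c - q := fun q hq => by
    push_cast [show q ≤ P.rho by omega]; ring
  have e2 : ∀ q < P.k, c - (P.rho : ℤ) + ((P.rho - q + P.k + P.D : ℕ) : ℤ) = c - q + P.gap :=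
    fun q hq => by unfold gap; push_cast [show q ≤ P.rho by omega]; ring
  have hv : ∀ q < P.k, ValidAt P.border Bl P.k P.D P.lam (window X P.rho c) (P.rho - q) ↔
      P.Valid X (c - (q : ℕ)) := fun q hq => by
    rw [validAt_window hB (by omega), e1 q hq]
  unfold LocalRel
  refine or_congr (exists_congr fun q => and_congr_right fun hq => ?_)
    (and_congr_left' (forall₂_congr fun q hq => (hv q hq).not))
  rw [hv q hq, validAt_window hB (by omega), factor_window, factor_window, e1 q hq, e2 q hq]
  constructor
  · rintro ⟨⟨b, hb⟩, ⟨w, v⟩, hw, h1, h2⟩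
    obtain ⟨d, d', rfl, rfl⟩ := (hg _ _).1 hw
    refine ⟨b, hb, ?_⟩
    simp only [List.cons.injEq, and_true] at h2
    rcases h2 with ⟨⟨b', hb'⟩, h2⟩ | ⟨hn, h2⟩
    · rw [hb.2, hb'.2] at h2
      exact Or.inl ⟨b', hb', by rw [h1, P.name_injective h2.1, P.name_injective h2.2]⟩
    · rw [hb.2] at h2
      exact Or.inr ⟨hn, by rw [h1, P.name_injective h2.1, P.name_injective h2.2]⟩
  · rintro ⟨b, hb, h⟩
    refine ⟨⟨b, hb⟩, ?_⟩
    rcases h with ⟨b', hb', h⟩ | ⟨hn, h⟩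
    · exact ⟨(_, P.name (P.rule b b')), (hg _ _).2 ⟨b, b', rfl, rfl⟩, h,
        Or.inl ⟨⟨b', hb'⟩, by rw [hb.2, hb'.2]⟩⟩
    · exact ⟨(_, P.name (P.rule b b)), (hg _ _).2 ⟨b, b, rfl, rfl⟩, h, Or.inr ⟨hn, by rw [hb.2]⟩⟩

theorem Disjoint.eq (hdis : P.Disjoint) {X : ℤ → ℕ} {c : ℤ} {q q' : ℕ} (hq : q < P.k)
    (hq' : q' < P.k) (h : P.Zone X (c - q)) (h' : P.Zone X (c - q')) : q = q' := by
  rcases le_total (c - (q : ℤ)) (c - (q' : ℤ)) with hle | hle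
  · have := hdis X _ _ h h' hle (by omega)
    omega
  · have := hdis X _ _ h' h hle (by omega)
    omega

/-- The local relation defines a simulation step. -/
theorem step_of_localRel {Bl : List (List ℕ)} {gt : List (List (List ℕ) × List ℕ)}
    (hB : ∀ w, w ∈ Bl ↔ ∃ b, w = P.name b)
    (hg : ∀ w v, (w, v) ∈ gt ↔ ∃ b b', w = [P.name b, P.name b'] ∧ v = P.name (P.rule b b'))
    (hdis : P.Disjoint) {X Y : ℤ → ℕ}
    (h : ∀ c, LocalRel P.border Bl gt P.k P.D P.lam P.rho P.outer (window X P.rho c) (Y c)) :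
    P.Step X Y := by
  simp only [localRel_window hB hg] at h
  have key : ∀ i b, P.Holds X i b → ∀ j < P.k,
      (∃ b', P.Holds X (i + P.gap) b' ∧ Y (i + (j : ℕ)) = (P.name (P.rule b b')).getD j 0) ∨
        (¬ P.Valid X (i + P.gap) ∧ Y (i + (j : ℕ)) = (P.name (P.rule b b)).getD j 0) := by
    intro i b hib j hj
    have hi : i + (j : ℤ) - j = i := by ring
    rcases h (i + (j : ℕ)) with ⟨q, hq, b', hb', h⟩ | ⟨h1, -⟩
    · obtain rfl := hdis.eq (c := i + (j : ℕ)) hq hj hb'.1 (by rw [hi]; exact hib.1)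
      rw [hi] at hb' h
      obtain rfl := hb'.unique hib
      exact h
    · have := h1 j hj
      rw [hi] at this
      exact absurd ⟨b, hib⟩ this
  refine ⟨?_, ?_, ?_⟩
  · intro i b b' hb hb'
    refine factorZ_eq_iff.2 ⟨P.length_name _, fun j hj => ?_⟩
    rcases key i b hb j hj with ⟨d, hd, h1⟩ | ⟨h1, -⟩
    · rw [hb'.unique hd, h1]
    · exact absurd ⟨b', hb'⟩ h1
  · intro i b hb hn
    refine factorZ_eq_iff.2 ⟨P.length_name _, fun j hj => ?_⟩
    rcases key i b hb j hj with ⟨d, hd, h1⟩ | ⟨-, h1⟩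
    · exact absurd ⟨d, hd⟩ hn
    · exact h1
  · intro c hc
    rcases h c with ⟨q, hq, b, h1, -⟩ | ⟨-, h1⟩
    · exact absurd ⟨b, h1⟩ (hc (c - (q : ℤ)) (by omega) (by omega))
    · exact h1

/-- The local relation is functional if the outer relation is. -/
theorem existsUnique_localRel {Bl : List (List ℕ)} {gt : List (List (List ℕ) × List ℕ)}
    (hB : ∀ w, w ∈ Bl ↔ ∃ b, w = P.name b)
    (hg : ∀ w v, (w, v) ∈ gt ↔ ∃ b b', w = [P.name b, P.name b'] ∧ v = P.name (P.rule b b'))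
    (hdis : P.Disjoint) {A : Set ℕ} (hA : ∀ b, ∀ n ∈ P.name b, n ∈ A)
    (ho : ∀ (X : ℤ → ℕ) (c : ℤ), (∀ i, X i ∈ A) → ∃ n ∈ A, ∀ n',
      P.outer (window X P.rho c) n' ↔ n' = n)
    {X : ℤ → ℕ} (hX : ∀ i, X i ∈ A) (c : ℤ) : ∃ n ∈ A, ∀ n',
      LocalRel P.border Bl gt P.k P.D P.lam P.rho P.outer (window X P.rho c) n' ↔ n' = n := by
  simp only [localRel_window hB hg]
  have hmem : ∀ d, ∀ q < P.k, (P.name d).getD q 0 ∈ A := fun d q hq => by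
    rw [List.getD_eq_getElem _ _ (by rw [P.length_name]; exact hq)]
    exact hA _ _ (List.getElem_mem _)
  by_cases h : ∃ q < P.k, P.Valid X (c - (q : ℕ))
  · obtain ⟨q, hq, b, hb⟩ := h
    have hno : ¬ ∀ q < P.k, ¬ P.Valid X (c - (q : ℕ)) := fun h => h q hq ⟨b, hb⟩
    by_cases hv : P.Valid X (c - q + P.gap)
    · obtain ⟨b', hb'⟩ := hv
      refine ⟨(P.name (P.rule b b')).getD q 0, hmem _ _ hq, fun n' => ⟨?_, ?_⟩⟩
      · rintro (⟨q', hq', d, hd, h⟩ | ⟨h, -⟩)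
        · obtain rfl := hdis.eq hq' hq hd.1 hb.1
          obtain rfl := hd.unique hb
          rcases h with ⟨d', hd', h⟩ | ⟨h, -⟩
          · rw [h, hd'.unique hb']
          · exact absurd ⟨b', hb'⟩ h
        · exact absurd h hno
      · rintro rfl
        exact Or.inl ⟨q, hq, b, hb, Or.inl ⟨b', hb', rfl⟩⟩
    · refine ⟨(P.name (P.rule b b)).getD q 0, hmem _ _ hq, fun n' => ⟨?_, ?_⟩⟩
      · rintro (⟨q', hq', d, hd, h⟩ | ⟨h, -⟩)
        · obtain rfl := hdis.eq hq' hq hd.1 hb.1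
          obtain rfl := hd.unique hb
          rcases h with ⟨d', hd', h⟩ | ⟨-, h⟩
          · exact absurd ⟨d', hd'⟩ hv
          · exact h
        · exact absurd h hno
      · rintro rfl
        exact Or.inl ⟨q, hq, b, hb, Or.inr ⟨hv, rfl⟩⟩
  · push Not at h
    obtain ⟨n, hn, hn'⟩ := ho X c hX
    refine ⟨n, hn, fun n' => ⟨?_, ?_⟩⟩
    · rintro (⟨q, hq, b, hb, -⟩ | ⟨-, h1⟩)
      · exact absurd ⟨b, hb⟩ (h q hq)
      · exact (hn' _).1 h1
    · rintro rfl
      exact Or.inr ⟨h, (hn' _).2 rfl⟩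

/-- Periodic arrangements of content zones simulate the rule. -/
theorem factorZ_orbit (hper : P.Persistent) {X : ℕ → ℤ → ℕ}
    (hX : ∀ t, P.Step (X t) (X (t + 1))) {c : ℤ} {y : ℤ → B}
    (h0 : ∀ n, P.Holds (X 0) (c + n * P.gap) (y n)) (t : ℕ) (n : ℤ) :
    P.Holds (X t) (c + n * P.gap) ((pushZ P.rule)^[t] y n) := by
  induction t generalizing n with
  | zero => exact h0 n
  | succ t ih =>
    refine ⟨hper _ _ (hX t) _ (ih n).1, ?_⟩
    rw [Function.iterate_succ_apply']
    refine (hX t).holds (ih n) ?_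
    have := ih (n + 1)
    rwa [show c + (n + 1) * P.gap = c + n * P.gap + P.gap by ring] at this

/-- If the set of content zones does not change, then their contents follow an orbit of the
rule. -/
theorem exists_orbit_of_stable {X : ℕ → ℤ → ℕ}
    (hX : ∀ t, P.Step (X t) (X (t + 1))) (hst : ∀ t i, P.Valid (X t) i ↔ P.Valid (X 0) i) {i : ℤ}
    (hi : P.Valid (X 0) i) :
    ∃ y : ℤ → B, ∀ t, P.Holds (X t) i ((pushZ P.rule)^[t] y 0) := by
  classical
  let pos : ℕ → ℤ := fun n => (fun j => if P.Valid (X 0) (j + P.gap) then j + P.gap else j)^[n] i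
  have hpos : ∀ n, pos (n + 1) =
      if P.Valid (X 0) (pos n + P.gap) then pos n + P.gap else pos n := fun n =>
    Function.iterate_succ_apply' _ _ _
  have hval : ∀ n, P.Valid (X 0) (pos n) := fun n => by
    induction n with
    | zero => exact hi
    | succ n ih => rw [hpos]; split_ifs with h <;> assumption
  have hval' : ∀ t n, P.Valid (X t) (pos n) := fun t n => (hst t _).2 (hval n)
  choose b hb using hval'
  have hstep : ∀ t n, b (t + 1) n = P.rule (b t n) (b t (n + 1)) := by
    intro t n
    refine P.name_injective ((hb (t + 1) n).2.symm.trans ?_)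
    by_cases h : P.Valid (X 0) (pos n + P.gap)
    · have h1 := hb t (n + 1)
      rw [hpos, if_pos h] at h1
      exact (hX t).holds (hb t n) h1
    · have h1 := hb t (n + 1)
      rw [hpos, if_neg h] at h1
      rw [h1.unique (hb t n)]
      exact (hX t).holds_last (hb t n) ((hst t _).not.2 h)
  refine ⟨fun n => b 0 n.toNat, fun t => ?_⟩
  have : ∀ t (n : ℕ), (pushZ P.rule)^[t] (fun n : ℤ => b 0 n.toNat) n = b t n := by
    intro t
    induction t with
    | zero => intro n; rfl
    | succ t ih =>
      intro n
      rw [Function.iterate_succ_apply', hstep, ← ih n, ← ih (n + 1)]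
      rfl
  have h0 := this t 0
  rw [Nat.cast_zero] at h0
  rw [h0]
  exact hb t 0

variable (P) in
/-- The configuration where the names of the letters of `y` alternate with a fixed border. -/
def arrange (w : ℕ → ℕ) (c : ℤ) (y : ℤ → B) (i : ℤ) : ℕ :=
  if ((i - c) % P.gap).toNat < P.k then (P.name (y ((i - c) / P.gap))).getD ((i - c) % P.gap).toNat 0
  else w (((i - c) % P.gap).toNat - P.k)

theorem arrange_zone {w : ℕ → ℕ} {c : ℤ} {y : ℤ → B} {n : ℤ} {j : ℕ} (hj : j < P.k) :
    P.arrange w c y (c + n * P.gap + j) = (P.name (y n)).getD j 0 := by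
  have hlt : (j : ℤ) < P.gap := by unfold gap; omega
  have h1 : (c + n * P.gap + j - c) % P.gap = j := by
    rw [show c + n * P.gap + j - c = j + n * P.gap by ring, Int.add_mul_emod_self_right,
      Int.emod_eq_of_lt (by omega) hlt]
  have h2 : (c + n * P.gap + j - c) / P.gap = n := by
    rw [show c + n * P.gap + j - c = j + n * P.gap by ring,
      Int.add_mul_ediv_right _ _ (by omega), Int.ediv_eq_zero_of_lt (by omega) hlt, zero_add]
  simp [arrange, h1, h2, hj]

theorem arrange_border {w : ℕ → ℕ} {c : ℤ} {y : ℤ → B} {n : ℤ} {j : ℕ} (hj : j < P.D) :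
    P.arrange w c y (c + n * P.gap + P.k + j) = w j := by
  have hlt : ((P.k + j : ℕ) : ℤ) < P.gap := by unfold gap; omega
  have h1 : (c + n * P.gap + P.k + j - c) % P.gap = (P.k + j : ℕ) := by
    rw [show c + n * P.gap + P.k + j - c = (P.k + j : ℕ) + n * P.gap by push_cast; ring,
      Int.add_mul_emod_self_right, Int.emod_eq_of_lt (by omega) hlt]
  unfold arrange
  rw [h1, Int.toNat_natCast, if_neg (by omega)]
  congr 1
  omega

theorem arrange_mem {A : Set ℕ} (hA : ∀ b, ∀ n ∈ P.name b, n ∈ A) {w : ℕ → ℕ}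
    (hw : ∀ j < P.D, w j ∈ A) (hpos : 0 < P.gap) (c : ℤ) (y : ℤ → B) (i : ℤ) :
    P.arrange w c y i ∈ A := by
  have h1 := Int.emod_nonneg (i - c) hpos.ne'
  have h2 := Int.emod_lt_of_pos (i - c) hpos
  unfold arrange
  split_ifs with h
  · rw [List.getD_eq_getElem _ _ (by rw [P.length_name]; exact h)]
    exact hA _ _ (List.getElem_mem _)
  · have hg : P.gap = P.k + P.D := rfl
    exact hw _ (by omega)

end Scheme

namespace Scheme

variable {B : Type*} {P : Scheme B}

theorem Valid.step (hper : P.Persistent) {X Y : ℤ → ℕ} (h : P.Step X Y) {i : ℤ}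
    (hi : P.Valid X i) : P.Valid Y i := by
  obtain ⟨b, hb⟩ := hi
  by_cases hv : P.Valid X (i + P.gap)
  · obtain ⟨b', hb'⟩ := hv
    exact ⟨_, hper _ _ h _ hb.1, h.holds hb hb'⟩
  · exact ⟨_, hper _ _ h _ hb.1, h.holds_last hb hv⟩

theorem Valid.le (hper : P.Persistent) {X : ℕ → ℤ → ℕ} (hX : ∀ t, P.Step (X t) (X (t + 1)))
    {i : ℤ} {s t : ℕ} (hst : s ≤ t) (hi : P.Valid (X s) i) : P.Valid (X t) i := by
  induction t, hst using Nat.le_induction with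
  | base => exact hi
  | succ t _ ih => exact ih.step hper (hX t)

/-- If content zones are stable from time `J` on, then all traces are known from this time on. -/
theorem trace_mem {S : Set (ℕ → ℕ)}
    (hS : ∀ y : ℤ → B, ∀ q < P.k, (fun t => (P.name ((pushZ P.rule)^[t] y 0)).getD q 0) ∈ S)
    {X : ℕ → ℤ → ℕ} (hX : ∀ t, P.Step (X t) (X (t + 1))) {J : ℕ}
    (hst : ∀ t i, P.Valid (X (J + t)) i ↔ P.Valid (X J) i)
    (hout : ∀ c : ℤ, (∀ i : ℤ, i ≤ c → c < i + P.k → ¬ P.Valid (X J) i) →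
      (fun t => X (J + t) c) ∈ S) (c : ℤ) : (fun t => X (J + t) c) ∈ S := by
  by_cases h : ∃ i : ℤ, i ≤ c ∧ c < i + P.k ∧ P.Valid (X J) i
  · obtain ⟨i, h1, h2, h3⟩ := h
    obtain ⟨y, hy⟩ := exists_orbit_of_stable (X := fun t => X (J + t)) (fun t => hX (J + t)) hst h3
    have hq : (c - i).toNat < P.k := by omega
    convert hS y _ hq using 2 with t
    rw [← (factorZ_eq_iff.1 (hy t).2).2 _ hq]
    congr 1
    omega
  · push Not at h
    exact hout c fun i h1 h2 => h i h1 h2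

/-- Every projection of a trace of the rule is a trace of the simulation. -/
theorem trace_arrange (hper : P.Persistent) {w : ℕ → ℕ}
    (hw : ∀ (c : ℤ) (y : ℤ → B) (n : ℤ), P.Border (P.arrange w c y) (c + n * P.gap + P.k))
    {q : ℕ} (hq : q < P.k) (y : ℤ → B) {X : ℕ → ℤ → ℕ} (hX : ∀ t, P.Step (X t) (X (t + 1)))
    (h0 : X 0 = P.arrange w (-(q : ℤ)) y) (t : ℕ) :
    X t 0 = (P.name ((pushZ P.rule)^[t] y 0)).getD q 0 := by
  have h := factorZ_orbit hper hX (c := -(q : ℤ)) (y := y) (fun n => ⟨⟨?_, ?_⟩, ?_⟩) t 0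
  · have h1 := (factorZ_eq_iff.1 h.2).2 q hq
    rw [← h1]
    congr 1
    ring
  · rw [h0]
    have := hw (-(q : ℤ)) y (n - 1)
    rwa [show -(q : ℤ) + (n - 1) * P.gap + P.k = -(q : ℤ) + n * P.gap - P.D by
      unfold gap; ring] at this
  · rw [h0]
    exact hw _ y n
  · rw [h0]
    exact factorZ_eq_iff.2 ⟨P.length_name _, fun j hj => arrange_zone hj⟩

end Scheme

/-! ### Borders made of the orbits of a letter map without fixed points -/

section Rotation

variable {B : Type*}

/-- The scheme where all cells out of content zones follow the letter map `η`. -/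
def rotScheme (η : ℕ → ℕ) (k rho : ℕ) (name : B → List ℕ) (rule : B → B → B)
    (hinj : Function.Injective name) (hlen : ∀ b, (name b).length = k) (hrho : 2 * k + 3 ≤ rho) :
    Scheme B where
  border := RotBorder η k
  k := k
  D := k + 3
  lam := 0
  rho := rho
  outer u n := n = η (u rho)
  name := name
  rule := rule
  name_injective := hinj
  length_name := hlen
  le_rho := by omega

variable {η : ℕ → ℕ} {k rho : ℕ} {name : B → List ℕ} {rule : B → B → B}
  {hinj : Function.Injective name} {hlen : ∀ b, (name b).length = k} {hrho : 2 * k + 3 ≤ rho}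

local notation "𝓡" => rotScheme η k rho name rule hinj hlen hrho

theorem rot_border_iff {X : ℤ → ℕ} {i : ℤ} : Scheme.Border 𝓡 X i ↔
    (∀ j : ℕ, j < k + 2 → X (i + j) = X i) ∧ X (i + k + 2) = η (X i) := by
  unfold Scheme.Border rotScheme RotBorder
  simp only [Nat.cast_zero, sub_zero, add_zero, Nat.cast_add, Nat.cast_ofNat, add_assoc]

theorem rot_border_overlap (hη : ∀ c, η c ≠ c) {X : ℤ → ℕ} {i i' : ℤ}
    (h : Scheme.Border 𝓡 X i) (h' : Scheme.Border 𝓡 X i') (h1 : i < i') : i + k + 1 < i' := by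
  rw [rot_border_iff] at h h'
  by_contra h2
  obtain ⟨d, hd⟩ := Int.eq_ofNat_of_zero_le (show 0 ≤ i' - i by omega)
  have e1 := h.1 d (by omega)
  have e2 := h'.1 (k + 2 - d) (by omega)
  rw [show i + (d : ℤ) = i' by omega] at e1
  rw [show i' + ((k + 2 - d : ℕ) : ℤ) = i + k + 2 by omega, h.2, e1] at e2
  exact hη _ e2

theorem rot_border_zone (hη : ∀ c, η c ≠ c) {X : ℤ → ℕ} {i j : ℤ}
    (h : Scheme.Zone 𝓡 X i) (h' : Scheme.Border 𝓡 X j) : j + k + 3 ≤ i ∨ i + k ≤ j := by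
  by_contra! hc
  have e1 : Scheme.Border 𝓡 X (i - (k + 3 : ℕ)) := h.1
  have e2 : Scheme.Border 𝓡 X (i + k) := h.2
  have h1 := rot_border_overlap hη h' e2 (by omega)
  rcases lt_or_ge (i - (k + 3 : ℕ)) j with h3 | h3
  · have h2 := rot_border_overlap hη e1 h' h3
    omega
  · omega

theorem rot_disjoint (hη : ∀ c, η c ≠ c) : Scheme.Disjoint 𝓡 := by
  intro X i i' h h' h1 h2
  have h2 : i' < i + k := h2
  rcases h1.eq_or_lt with h1 | h1
  · exact h1
  · have e1 : Scheme.Border 𝓡 X (i + k) := h.2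
    have e2 : Scheme.Border 𝓡 X (i' + k) := h'.2
    have := rot_border_overlap hη e1 e2 (by omega)
    omega

theorem rot_outer {X Y : ℤ → ℕ} (h : Scheme.Step 𝓡 X Y) {c : ℤ}
    (hc : ∀ i : ℤ, i ≤ c → c < i + k → ¬ Scheme.Valid 𝓡 X i) : Y c = η (X c) := by
  have : Y c = η (window X rho c rho) := h.outer c hc
  simpa [window] using this

theorem rot_border_step (hη : ∀ c, η c ≠ c) {X Y : ℤ → ℕ} (h : Scheme.Step 𝓡 X Y) {i : ℤ}
    (hi : Scheme.Border 𝓡 X i) : Scheme.Border 𝓡 Y i := by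
  have key : ∀ c : ℤ, i ≤ c → c < i + k + 3 → Y c = η (X c) := fun c h1 h2 =>
    rot_outer h fun j h3 h4 ⟨b, hb⟩ => by
      have := rot_border_zone hη hb.1 hi
      omega
  rw [rot_border_iff] at hi ⊢
  refine ⟨fun j hj => ?_, ?_⟩
  · rw [key _ (by omega) (by omega), key _ (by omega) (by omega), hi.1 j hj]
  · rw [key _ (by omega) (by omega), key _ (by omega) (by omega), hi.2]

theorem rot_persistent (hη : ∀ c, η c ≠ c) : Scheme.Persistent 𝓡 :=
  fun _ _ h _ hi => ⟨rot_border_step hη h hi.1, rot_border_step hη h hi.2⟩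

theorem rot_iterate {X : ℕ → ℤ → ℕ}
    (hX : ∀ t, Scheme.Step 𝓡 (X t) (X (t + 1))) {c : ℤ} {t : ℕ}
    (hc : ∀ s < t, ∀ i : ℤ, i ≤ c → c < i + k → ¬ Scheme.Valid 𝓡 (X s) i) {s : ℕ} (hs : s ≤ t) :
    X s c = η^[s] (X 0 c) := by
  induction s with
  | zero => rfl
  | succ s ih =>
    rw [Function.iterate_succ_apply', ← ih (by omega)]
    exact rot_outer (hX s) (hc s (by omega))

theorem rot_border_le (hη : ∀ c, η c ≠ c) {X : ℕ → ℤ → ℕ}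
    (hX : ∀ t, Scheme.Step 𝓡 (X t) (X (t + 1))) {i : ℤ} {s t : ℕ} (hst : s ≤ t)
    (hi : Scheme.Border 𝓡 (X s) i) : Scheme.Border 𝓡 (X t) i := by
  induction t, hst using Nat.le_induction with
  | base => exact hi
  | succ t _ ih => exact rot_border_step hη (hX t) ih

theorem iterate_add_mod {n₀ q : ℕ} (hq : η^[n₀ + q] = η^[n₀]) {J t : ℕ} (hJ : n₀ ≤ J) (ht : J ≤ t) :
    η^[t] = η^[J + (t - J) % q] := by
  have h1 : ∀ m r, η^[J + r + m * q] = η^[J + r] := by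
    intro m r
    induction m with
    | zero => simp
    | succ m ih =>
      rw [show J + r + (m + 1) * q = (J - n₀ + r + m * q) + (n₀ + q) by
        rw [add_mul]; omega, Function.iterate_add, hq, ← Function.iterate_add,
        show J - n₀ + r + m * q + n₀ = J + r + m * q by omega, ih]
  have h2 := Nat.mod_add_div' (t - J) q
  have h3 := h1 ((t - J) / q) ((t - J) % q)
  rwa [show J + (t - J) % q + (t - J) / q * q = t by omega] at h3

theorem rot_border_stable (hη : ∀ c, η c ≠ c) {n₀ q : ℕ} (hq0 : 0 < q)
    (hq : η^[n₀ + q] = η^[n₀]) {X : ℕ → ℤ → ℕ} (hX : ∀ t, Scheme.Step 𝓡 (X t) (X (t + 1)))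
    {i : ℤ} {s t : ℕ} (hs : n₀ + q ≤ s) (ht : n₀ ≤ t) (hi : Scheme.Border 𝓡 (X t) i) :
    Scheme.Border 𝓡 (X s) i := by
  have hmod := Nat.mod_lt (t - n₀) hq0
  have hle := Nat.mod_le (t - n₀) q
  have key : ∀ c : ℤ, i ≤ c → c < i + k + 3 → ∀ r ≤ t, X r c = η^[r] (X 0 c) :=
    fun c h1 h2 r hr => rot_iterate hX (t := t) (fun u hu j h3 h4 hv => by
      have hv' := hv.le (rot_persistent hη) hX hu.le
      obtain ⟨b, hb⟩ := hv'
      have := rot_border_zone hη hb.1 hi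
      omega) hr
  have heq : ∀ c : ℤ, i ≤ c → c < i + k + 3 → X (n₀ + (t - n₀) % q) c = X t c :=
    fun c h1 h2 => by
      rw [key c h1 h2 _ (by omega), key c h1 h2 t le_rfl, iterate_add_mod hq le_rfl ht]
  refine rot_border_le hη hX (s := n₀ + (t - n₀) % q) (by omega) ?_
  rw [rot_border_iff] at hi ⊢
  refine ⟨fun j hj => ?_, ?_⟩
  · rw [heq _ (by omega) (by omega), heq _ (by omega) (by omega), hi.1 j hj]
  · rw [heq _ (by omega) (by omega), heq _ (by omega) (by omega), hi.2]

theorem rot_valid_stable (hη : ∀ c, η c ≠ c) {n₀ q : ℕ} (hq0 : 0 < q)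
    (hq : η^[n₀ + q] = η^[n₀]) {X : ℕ → ℤ → ℕ} (hX : ∀ t, Scheme.Step 𝓡 (X t) (X (t + 1)))
    (t : ℕ) (i : ℤ) : Scheme.Valid 𝓡 (X (n₀ + q + q + t)) i ↔ Scheme.Valid 𝓡 (X (n₀ + q + q)) i := by
  classical
  refine ⟨fun h => ?_, fun h => h.le (rot_persistent hη) hX (by omega)⟩
  have hex : ∃ t, Scheme.Valid 𝓡 (X t) i := ⟨_, h⟩
  have hu := Nat.find_spec hex
  have hmin : ∀ s < Nat.find hex, ¬ Scheme.Valid 𝓡 (X s) i := fun s hs => Nat.find_min hex hs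
  set u := Nat.find hex
  rcases lt_or_ge u (n₀ + q + q) with hlt | hge
  · exact hu.le (rot_persistent hη) hX hlt.le
  exfalso
  have hmod := Nat.mod_lt (u - (n₀ + q)) hq0
  set r := n₀ + q + (u - (n₀ + q)) % q with hr
  obtain ⟨b, hb⟩ := hu
  have key : ∀ c : ℤ, i ≤ c → c < i + k → ∀ s ≤ u, X s c = η^[s] (X 0 c) :=
    fun c h1 h2 s hs => rot_iterate hX (t := u) (fun v hv j h3 h4 hj => by
      obtain ⟨b', hb'⟩ := hj.le (rot_persistent hη) hX hv.le
      have hij : i = j := by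
        rcases le_total i j with hle | hle
        · exact rot_disjoint hη _ _ _ hb.1 hb'.1 hle (show j < i + (k : ℤ) by omega)
        · exact (rot_disjoint hη _ _ _ hb'.1 hb.1 hle (show i < j + (k : ℤ) by omega)).symm
      subst hij
      exact hmin v hv hj) hs
  refine hmin r (by omega) ⟨b, ⟨?_, ?_⟩, ?_⟩
  · exact rot_border_stable hη hq0 hq hX (by omega) (by omega) hb.1.1
  · exact rot_border_stable hη hq0 hq hX (by omega) (by omega) hb.1.2
  · rw [← hb.2]
    refine List.map_congr_left fun j hj => ?_
    have hj : j < k := List.mem_range.1 hj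
    rw [key _ (by omega) (by omega) r (by omega), key _ (by omega) (by omega) u le_rfl,
      iterate_add_mod hq (show n₀ ≤ n₀ + q by omega) (show n₀ + q ≤ u by omega)]

theorem rot_trace (hη : ∀ c, η c ≠ c) {n₀ q : ℕ} (hq0 : 0 < q) (hq : η^[n₀ + q] = η^[n₀])
    {S : Set (ℕ → ℕ)} (hS : ∀ y : ℤ → B, ∀ q < k,
      (fun t => (name ((pushZ rule)^[t] y 0)).getD q 0) ∈ S)
    (hηS : ∀ n c, (fun t => η^[n + 1 + t] c) ∈ S)
    {X : ℕ → ℤ → ℕ} (hX : ∀ t, Scheme.Step 𝓡 (X t) (X (t + 1))) (c : ℤ) :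
    (fun t => X (n₀ + q + q + t) c) ∈ S := by
  refine Scheme.trace_mem (P := 𝓡) hS hX (rot_valid_stable hη hq0 hq hX) (fun c hc => ?_) c
  have : (fun t => X (n₀ + q + q + t) c) = fun t => η^[n₀ + q + q - 1 + 1 + t] (X 0 c) := by
    funext t
    rw [show n₀ + q + q - 1 + 1 + t = n₀ + q + q + t by omega]
    refine rot_iterate hX (t := n₀ + q + q + t) (fun s hs i h1 h2 hv => ?_) le_rfl
    exact hc i h1 h2 ((rot_valid_stable hη hq0 hq hX t i).1
      (hv.le (rot_persistent hη) hX hs.le))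
  rw [this]
  exact hηS _ _

/-- A border for `rotScheme`. -/
def rotWord (η : ℕ → ℕ) (k b : ℕ) (j : ℕ) : ℕ := if j < k + 2 then b else η b

theorem rot_border_arrange (b : ℕ) (c : ℤ) (y : ℤ → B) (n : ℤ) :
    Scheme.Border 𝓡 (Scheme.arrange 𝓡 (rotWord η k b) c y) (c + n * Scheme.gap 𝓡 + k) := by
  have h : ∀ j : ℕ, j < k + 3 → Scheme.arrange 𝓡 (rotWord η k b) c y
      (c + n * Scheme.gap 𝓡 + k + j) = rotWord η k b j := fun j hj =>
    Scheme.arrange_border (P := 𝓡) hj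
  rw [rot_border_iff]
  have h0 := h 0 (by omega)
  rw [Nat.cast_zero, add_zero] at h0
  rw [h0]
  refine ⟨fun j hj => ?_, ?_⟩
  · rw [h j (by omega)]
    simp [rotWord, hj]
  · have h2 := h (k + 2) (by omega)
    push_cast at h2
    rw [← add_assoc] at h2
    rw [h2]
    simp [rotWord]

end Rotation

/-! ### Borders made of a periodic word between constant pads -/

/-- `z` is a sequence of period `p`, other than the constant `a`. -/
structure IsCoreData (z : ℕ → ℕ) (a p : ℕ) : Prop where
  pos : 0 < p
  periodic : ∀ j, z (j + p) = z j
  ne : ∃ j, z j ≠ a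

section Core

variable {z : ℕ → ℕ} {a p m k : ℕ}

theorem IsCoreData.add_mul (h : IsCoreData z a p) (j r : ℕ) : z (j + p * r) = z j := by
  induction r with
  | zero => rfl
  | succ r ih => rw [mul_add, mul_one, ← add_assoc, h.periodic, ih]

theorem IsCoreData.eq_of_window (h : IsCoreData z a p) {n n' : ℕ}
    (hw : ∀ i < p, z (n + i) = z (n' + i)) (i : ℕ) : z (n + i) = z (n' + i) := by
  have := hw _ (Nat.mod_lt i h.pos)
  rwa [← h.add_mul _ (i / p), ← h.add_mul (n' + i % p) (i / p), add_assoc, add_assoc,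
    Nat.mod_add_div] at this

theorem IsCoreData.const_of_window (h : IsCoreData z a p) {n b : ℕ}
    (hw : ∀ i < p, z (n + i) = b) (j : ℕ) : z j = b := by
  have h1 : z j = z (n + (j + (p - 1) * n)) := by
    rw [show n + (j + (p - 1) * n) = j + p * n by
      obtain ⟨q, rfl⟩ := Nat.exists_eq_succ_of_ne_zero h.pos.ne'
      simp only [Nat.succ_eq_add_one, Nat.add_sub_cancel]; ring, h.add_mul]
  rw [h1, ← hw _ (Nat.mod_lt (j + (p - 1) * n) h.pos)]
  conv_lhs => rw [← Nat.mod_add_div (j + (p - 1) * n) p, ← add_assoc, h.add_mul]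

theorem core_of_lt {t j : ℕ} (hj : j < m) : core z m t j = z (t + j) := by
  simp [core, Nat.div_eq_of_lt hj]

theorem core_block {t h r : ℕ} (hr : r < m) : core z m t (h * m + r) = z (t + h * m + r + h) := by
  unfold core
  rw [mul_comm h m, Nat.mul_add_div (by omega), Nat.div_eq_of_lt hr, add_zero, ← add_assoc]

/-- The blocks of a core are longer than two periods. -/
theorem IsCoreData.two_mul_le (hm : m = 2 * p * (k + 1)) : 2 * p ≤ m := by
  rw [hm]; exact Nat.le_mul_of_pos_right _ (by omega)

theorem IsCoreData.add_le (h : IsCoreData z a p) (hm : m = 2 * p * (k + 1)) :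
    k + 2 * p ≤ m * p := by
  have := h.pos
  rw [hm]
  nlinarith [Nat.zero_le (p * p * k), Nat.zero_le ((p - 1) * k), Nat.mul_le_mul this this,
    Nat.mul_le_mul this (le_refl p), Nat.mul_le_mul (Nat.mul_le_mul this this) (le_refl k)]

theorem IsCoreData.not_left (h : IsCoreData z a p) (hm : 2 * p ≤ m) {t : ℕ}
    (hc : ∀ j < p, core z m t j = a) : False := by
  obtain ⟨j, hj⟩ := h.ne
  refine hj (h.const_of_window (n := t) (fun i hi => ?_) j)
  rw [← hc i hi, core_of_lt (by omega)]

theorem IsCoreData.not_right (h : IsCoreData z a p) (hm : 2 * p ≤ m) {t : ℕ}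
    (hc : ∀ j < m * p, m * p ≤ j + p → core z m t j = a) : False := by
  obtain ⟨j, hj⟩ := h.ne
  have hp := h.pos
  have e : m * p = (p - 1) * m + m := by
    rw [← Nat.succ_mul, Nat.succ_eq_add_one, Nat.sub_add_cancel hp, mul_comm]
  refine hj (h.const_of_window (n := t + (p - 1) * m + (m - p) + (p - 1)) (fun i hi => ?_) j)
  rw [← hc ((p - 1) * m + (m - p + i)) (by omega) (by omega), core_block (by omega)]
  congr 1
  omega

theorem IsCoreData.core_succ (h : IsCoreData z a p) (hm : 2 * p ≤ m) {s t : ℕ}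
    (hc : ∀ j < m * p, core z m s j = core z m t j) (j : ℕ) :
    core z m (s + 1) j = core z m (t + 1) j := by
  have hp := h.pos
  have h1 := h.eq_of_window (n := s) (n' := t) fun i hi => by
    rw [← core_of_lt (z := z) (m := m) (t := s) (j := i) (by omega),
      ← core_of_lt (z := z) (m := m) (t := t) (j := i) (by omega),
      hc i (by nlinarith)]
  unfold core
  rw [show s + 1 + j + j / m = s + (1 + j + j / m) by omega,
    show t + 1 + j + j / m = t + (1 + j + j / m) by omega, h1]

theorem IsCoreData.core_mod (h : IsCoreData z a p) (t j : ℕ) :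
    core z m (t % p) j = core z m t j := by
  unfold core
  conv_rhs => rw [← Nat.mod_add_div t p]
  rw [show t % p + p * (t / p) + j + j / m = t % p + j + j / m + p * (t / p) by omega, h.add_mul]

/-- A core does not overlap a shifted core if the overhanging cells of one of them are `a`. -/
theorem IsCoreData.core_shift (h : IsCoreData z a p) (hm : m = 2 * p * (k + 1)) {s t δ : ℕ}
    (h0 : 0 < δ)
    (hc : ∀ j, j + δ < m * p → core z m s j = core z m t (j + δ))
    (ha : (∀ j < δ, core z m t j = a) ∨ ∀ j < m * p, m * p ≤ j + δ → core z m s j = a) :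
    False := by
  have hp := h.pos
  have h2 := IsCoreData.two_mul_le (k := k) hm
  have hMp : m ≤ m * p := Nat.le_mul_of_pos_right _ hp
  have hδ : δ < p := by
    by_contra! hle
    rcases ha with ha | ha
    · exact h.not_left h2 fun j hj => ha j (by omega)
    · exact h.not_right h2 fun j hj hj' => ha j hj (by omega)
  have e1 : ∀ i, z (s + i) = z (t + δ + i) := h.eq_of_window fun i hi => by
    rw [← core_of_lt (z := z) (m := m) (t := s) (j := i) (by omega), hc i (by omega), core_of_lt (by omega)]
    congr 1
    omega
  have e2 : ∀ i, i + 1 < p → z (s + p - 1 + i) = z (s + p - 1 + (i + 1)) := by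
    intro i hi
    have hb : (i + 1) * m + m ≤ m * p := by
      rw [← Nat.succ_mul, mul_comm]
      exact Nat.mul_le_mul_left m (by omega)
    have h3 := hc (i * m + (m - 1)) (by rw [Nat.succ_mul] at hb; omega)
    rw [core_block (by omega), show i * m + (m - 1) + δ = (i + 1) * m + (δ - 1) by
      rw [Nat.succ_mul]; omega, core_block (by omega)] at h3
    have e3 : (i + 1) * m = p + p * (2 * (k + 1) * (i + 1) - 1) := by
      have : 1 ≤ 2 * (k + 1) * (i + 1) := Nat.mul_pos (by omega) (by omega)
      rw [hm]
      conv_rhs => rw [show p + p * (2 * (k + 1) * (i + 1) - 1) =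
        p * (2 * (k + 1) * (i + 1) - 1 + 1) by ring, Nat.sub_add_cancel this]
      ring
    set r := 2 * (k + 1) * (i + 1) - 1
    have e4 : i * m + m = p + p * r := by rw [← Nat.succ_mul]; exact e3
    rw [show s + i * m + (m - 1) + i = s + p - 1 + i + p * r by omega, h.add_mul,
      show t + (i + 1) * m + (δ - 1) + (i + 1) = t + δ + (p + p * r + i) by omega, ← e1,
      show s + (p + p * r + i) = s + p - 1 + (i + 1) + p * r by omega, h.add_mul] at h3
    exact h3
  have e5 : ∀ i < p, z (s + p - 1 + i) = z (s + p - 1) := by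
    intro i
    induction i with
    | zero => intro _; rfl
    | succ i ih => intro hi; rw [← e2 i hi, ih (by omega)]
  have hconst := h.const_of_window e5
  obtain ⟨j, hj⟩ := h.ne
  rcases ha with ha | ha
  · have := ha 0 h0
    unfold core at this
    rw [hconst] at this
    rw [hconst, this] at hj
    exact hj rfl
  · have := ha (m * p - 1) (by omega) (by omega)
    unfold core at this
    rw [hconst] at this
    rw [hconst, this] at hj
    exact hj rfl

end Core

section Pad

variable {z : ℕ → ℕ} {a p m k : ℕ}

/-- A core occurs at position `i`. -/
def CoreZ (z : ℕ → ℕ) (p m : ℕ) (X : ℤ → ℕ) (i : ℤ) : Prop :=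
  ∃ t, ∀ j : ℕ, j < m * p → X (i + j) = core z m t j

/-- An isolated core between pads occurs at position `i`. -/
structure Isolated (z : ℕ → ℕ) (a p m : ℕ) (X : ℤ → ℕ) (i : ℤ) : Prop where
  coreZ : CoreZ z p m X i
  left : ∀ c : ℤ, i - (m * p : ℕ) ≤ c → c < i → X c = a
  right : ∀ c : ℤ, i + (m * p : ℕ) ≤ c → c < i + 2 * (m * p : ℕ) → X c = a
  unique : ∀ i' : ℤ, i - 2 * (m * p : ℕ) < i' → i' < i + 2 * (m * p : ℕ) → CoreZ z p m X i' → i' = i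

/-- If the cells outside of given cores and content zones are `a`, then there is no other core. -/
theorem coreZ_of_layout (h : IsCoreData z a p) (hm : m = 2 * p * (k + 1)) {Y : ℤ → ℕ}
    {C Z : ℤ → Prop} (h1 : ∀ i, C i → CoreZ z p m Y i)
    (h2 : ∀ i, C i → ∀ c : ℤ, i - (m * p : ℕ) ≤ c → c < i → Y c = a)
    (h2' : ∀ i, C i → ∀ c : ℤ, i + (m * p : ℕ) ≤ c → c < i + 2 * (m * p : ℕ) → Y c = a)
    (h3 : ∀ i, Z i → C (i - 2 * (m * p : ℕ)) ∧ C (i + k + (m * p : ℕ)))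
    (h4 : ∀ c : ℤ, (∀ i, C i → i ≤ c → c < i + (m * p : ℕ) → False) →
      (∀ i, Z i → i ≤ c → c < i + k → False) → Y c = a) {i : ℤ} (hi : CoreZ z p m Y i) : C i := by
  have hp := h.pos
  have hle := IsCoreData.two_mul_le (k := k) hm
  have hkM := h.add_le hm
  set M := m * p with hM
  obtain ⟨s, hs⟩ := hi
  by_contra hni
  by_cases hC : ∃ i', C i' ∧ i' < i + M ∧ i < i' + M
  · obtain ⟨i', hi', hlt, hlt'⟩ := hC
    obtain ⟨t, ht⟩ := h1 i' hi'
    rcases lt_trichotomy i i' with hii | rfl | hii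
    · obtain ⟨d, hd⟩ := Int.eq_ofNat_of_zero_le (show 0 ≤ i' - i by omega)
      refine h.core_shift hm (s := t) (t := s) (δ := d) (by omega)
        (fun j hj => ?_) (Or.inl fun j hj => ?_)
      · rw [← ht j (by omega), ← hs (j + d) hj]
        congr 1
        push_cast
        omega
      · rw [← hs j (by omega)]
        exact h2 i' hi' _ (by omega) (by omega)
    · exact hni hi'
    · obtain ⟨d, hd⟩ := Int.eq_ofNat_of_zero_le (show 0 ≤ i - i' by omega)
      refine h.core_shift hm (s := s) (t := t) (δ := d) (by omega)
        (fun j hj => ?_) (Or.inr fun j hj hj' => ?_)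
      · rw [← hs j (by omega), ← ht (j + d) hj]
        congr 1
        push_cast
        omega
      · rw [← hs j (by omega)]
        exact h2' i' hi' _ (by omega) (by omega)
  · push Not at hC
    by_cases hZ : ∃ i₀, Z i₀ ∧ i₀ < i + M ∧ i < i₀ + k
    · obtain ⟨i₀, hi₀, hlt, hlt'⟩ := hZ
      obtain ⟨c1, c2⟩ := h3 i₀ hi₀
      rcases le_or_gt (i + p) i₀ with hle' | hgt
      · refine h.not_left hle (t := s) fun j hj => ?_
        rw [← hs j (by omega)]
        exact h2' _ c1 _ (by omega) (by omega)
      · refine h.not_right hle (t := s) fun j hj hj' => ?_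
        rw [← hs j (by omega)]
        exact h2 _ c2 _ (by omega) (by omega)
    · push Not at hZ
      refine h.not_left hle (t := s) fun j hj => ?_
      rw [← hs j (by omega)]
      refine h4 _ (fun i' hi' h5 h6 => ?_) fun i₀ hi₀ h5 h6 => ?_
      · have := hC i' hi' (by omega)
        omega
      · have := hZ i₀ hi₀ (by omega)
        omega

end Pad

section Pad

variable {B : Type*} {z : ℕ → ℕ} {a p m k : ℕ}

/-- The scheme whose borders are isolated cores between pads, and where the other cells out of
content zones take the letter `a`. -/
def padScheme (z : ℕ → ℕ) (a p m k rho : ℕ) (name : B → List ℕ) (rule : B → B → B)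
    (hinj : Function.Injective name) (hlen : ∀ b, (name b).length = k)
    (hrho : k + 4 * (m * p) ≤ rho) : Scheme B where
  border := PadBorder z a p m
  k := k
  D := 3 * (m * p)
  lam := m * p
  rho := rho
  outer := PadRel z a p m rho
  name := name
  rule := rule
  name_injective := hinj
  length_name := hlen
  le_rho := by omega

theorem coreZ_iff (h : IsCoreData z a p) {X : ℤ → ℕ} {i : ℤ} :
    CoreZ z p m X i ↔ ∃ t < p, ∀ j : ℕ, j < m * p → X (i + j) = core z m t j := by
  constructor
  · rintro ⟨t, ht⟩
    exact ⟨t % p, Nat.mod_lt _ h.pos, fun j hj => by rw [h.core_mod]; exact ht j hj⟩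
  · rintro ⟨t, -, ht⟩
    exact ⟨t, ht⟩

theorem padBorder_iff (h : IsCoreData z a p) {X : ℤ → ℕ} {i : ℤ} :
    PadBorder z a p m (fun j : ℕ => X (i - 2 * (m * p : ℕ) + j)) ↔ Isolated z a p m X i := by
  set M := m * p with hM
  have hcore : ∀ o : ℕ, CoreAt z p m (fun j : ℕ => X (i - 2 * (M : ℕ) + j)) o ↔
      CoreZ z p m X (i - 2 * (M : ℕ) + o) := fun o => by
    rw [coreZ_iff h]
    unfold CoreAt
    simp only [Nat.cast_add, add_assoc]
  unfold PadBorder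
  simp only [hcore, ← hM]
  constructor
  · rintro ⟨h1, h2, h3⟩
    refine ⟨?_, fun c hc hc' => ?_, fun c hc hc' => ?_, fun i' hi hi' hcz => ?_⟩
    · convert h1 using 1
      push_cast
      ring
    · have := (h2 (c - (i - M)).toNat (by omega)).1
      rwa [show i - 2 * (M : ℤ) + ((M + (c - (i - M)).toNat : ℕ) : ℤ) = c by omega] at this
    · have := (h2 (c - (i + M)).toNat (by omega)).2
      rwa [show i - 2 * (M : ℤ) + ((3 * M + (c - (i + M)).toNat : ℕ) : ℤ) = c by omega] at this
    · rcases h3 (i' - (i - 2 * M)).toNat (by omega) with h4 | h4 | h4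
      · omega
      · omega
      · refine absurd ?_ h4
        convert hcz using 1
        omega
  · rintro ⟨h1, h2, h3, h4⟩
    refine ⟨?_, fun j hj => ⟨h2 _ (by omega) (by omega), h3 _ (by omega) (by omega)⟩,
      fun o ho => ?_⟩
    · convert h1 using 1
      push_cast
      ring
    · by_contra! hc
      have := h4 _ (by omega) (by omega) hc.2.2
      omega

theorem padRel_iff (h : IsCoreData z a p) {rho : ℕ} (hrho : k + 4 * (m * p) ≤ rho) {X : ℤ → ℕ}
    {c : ℤ} {n : ℕ} : PadRel z a p m rho (window X rho c) n ↔
      (∃ j < m * p, Isolated z a p m X (c - (j : ℕ)) ∧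
        ∃ t < p, (∀ i : ℕ, i < m * p → X (c - (j : ℕ) + i) = core z m t i) ∧
          n = core z m (t + 1) j) ∨
      ((∀ j < m * p, ¬ Isolated z a p m X (c - (j : ℕ))) ∧ n = a) := by
  have e : ∀ j < m * p, (fun i => window X rho c (rho - j - 2 * (m * p) + i)) =
      fun i : ℕ => X (c - (j : ℕ) - 2 * (m * p : ℕ) + i) := fun j hj => by
    funext i
    unfold window
    congr 1
    omega
  have e' : ∀ j < m * p, ∀ i, window X rho c (rho - j + i) = X (c - (j : ℕ) + i) :=
    fun j hj i => by
      unfold window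
      congr 1
      omega
  unfold PadRel
  refine or_congr (exists_congr fun j => and_congr_right fun hj => ?_)
    (and_congr_left' (forall₂_congr fun j hj => ?_))
  · rw [e j hj, padBorder_iff h]
    simp only [e' j hj]
  · rw [e j hj, padBorder_iff h]

/-- The relation outside of content zones is functional. -/
theorem padRel_existsUnique (h : IsCoreData z a p) (hm : 2 * p ≤ m) {rho : ℕ}
    (hrho : k + 4 * (m * p) ≤ rho) {A : Set ℕ} (ha : a ∈ A) (hz : ∀ j, z j ∈ A) (X : ℤ → ℕ)
    (c : ℤ) : ∃ n ∈ A, ∀ n', PadRel z a p m rho (window X rho c) n' ↔ n' = n := by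
  simp only [padRel_iff h hrho]
  by_cases hc : ∃ j < m * p, Isolated z a p m X (c - (j : ℕ))
  · obtain ⟨j, hj, hI⟩ := hc
    obtain ⟨t, htp, ht⟩ := (coreZ_iff h).1 hI.coreZ
    refine ⟨core z m (t + 1) j, hz _, fun n' => ⟨?_, ?_⟩⟩
    · rintro (⟨j', hj', hI', s, -, hs, rfl⟩ | ⟨hn, -⟩)
      · have := hI.unique _ (by omega) (by omega) hI'.coreZ
        obtain rfl : j' = j := by omega
        exact h.core_succ hm (fun i hi => by rw [← hs i hi, ← ht i hi]) _
      · exact absurd hI (hn j hj)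
    · rintro rfl
      exact Or.inl ⟨j, hj, hI, t, htp, ht, rfl⟩
  · push Not at hc
    refine ⟨a, ha, fun n' => ⟨?_, ?_⟩⟩
    · rintro (⟨j, hj, hI, -⟩ | ⟨-, hn⟩)
      · exact absurd hI (hc j hj)
      · exact hn
    · rintro rfl
      exact Or.inr ⟨hc, rfl⟩

variable {rho : ℕ} {name : B → List ℕ} {rule : B → B → B}
  {hinj : Function.Injective name} {hlen : ∀ b, (name b).length = k}
  {hrho : k + 4 * (m * p) ≤ rho}

local notation "𝓟" => padScheme z a p m k rho name rule hinj hlen hrho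

theorem pad_border_iff (h : IsCoreData z a p) {X : ℤ → ℕ} {i : ℤ} :
    Scheme.Border 𝓟 X i ↔ Isolated z a p m X (i + (m * p : ℕ)) := by
  rw [← padBorder_iff h]
  unfold Scheme.Border padScheme
  simp only
  rw [show i + ((m * p : ℕ) : ℤ) - 2 * ((m * p : ℕ) : ℤ) = i - (m * p : ℕ) by ring]

theorem pad_zone_iff (h : IsCoreData z a p) {X : ℤ → ℕ} {i : ℤ} :
    Scheme.Zone 𝓟 X i ↔ Isolated z a p m X (i - 2 * (m * p : ℕ)) ∧
      Isolated z a p m X (i + k + (m * p : ℕ)) := by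
  unfold Scheme.Zone
  rw [pad_border_iff h, pad_border_iff h]
  unfold padScheme
  simp only
  rw [show i - ((3 * (m * p) : ℕ) : ℤ) + (m * p : ℕ) = i - 2 * (m * p : ℕ) by push_cast; ring]

theorem isolated_zone (h : IsCoreData z a p) (hm : m = 2 * p * (k + 1)) {X : ℤ → ℕ} {i j : ℤ}
    (hz : Scheme.Zone 𝓟 X i) (hj : Isolated z a p m X j) :
    j + 2 * (m * p : ℕ) ≤ i ∨ i + k + (m * p : ℕ) ≤ j := by
  have hp := h.pos
  have hkM := h.add_le hm
  obtain ⟨h1, h2⟩ := (pad_zone_iff h).1 hz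
  by_contra! hc
  rcases lt_or_ge j i with hlt | hge
  · have := h1.unique j (by omega) (by omega) hj.coreZ
    omega
  · have := h2.unique j (by omega) (by omega) hj.coreZ
    omega

theorem pad_disjoint (h : IsCoreData z a p) (hm : m = 2 * p * (k + 1)) : Scheme.Disjoint 𝓟 := by
  intro X i i' hi hi' h1 h2
  have h2 : i' < i + k := h2
  have h3 := isolated_zone h hm hi ((pad_zone_iff h).1 hi').1
  omega

theorem pad_outer (h : IsCoreData z a p) {X Y : ℤ → ℕ} (hs : Scheme.Step 𝓟 X Y) {c : ℤ}
    (hc : ∀ i : ℤ, i ≤ c → c < i + k → ¬ Scheme.Valid 𝓟 X i)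
    (hI : ∀ i, Isolated z a p m X i → i ≤ c → c < i + (m * p : ℕ) → False) : Y c = a := by
  rcases (padRel_iff h hrho).1 (hs.outer c hc) with ⟨j, hj, hIj, -⟩ | ⟨-, h1⟩
  · exact (hI _ hIj (by omega) (by omega)).elim
  · exact h1

theorem pad_core_step (h : IsCoreData z a p) (hm : m = 2 * p * (k + 1)) {X Y : ℤ → ℕ}
    (hs : Scheme.Step 𝓟 X Y) {i : ℤ} (hi : Isolated z a p m X i) {t : ℕ}
    (ht : ∀ j : ℕ, j < m * p → X (i + j) = core z m t j) {j : ℕ} (hj : j < m * p) :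
    Y (i + j) = core z m (t + 1) j := by
  have hc : ∀ i' : ℤ, i' ≤ i + j → i + j < i' + k → ¬ Scheme.Valid 𝓟 X i' := by
    rintro i' h1 h2 ⟨b, hb⟩
    have := isolated_zone h hm hb.1 hi
    omega
  rcases (padRel_iff h hrho).1 (hs.outer _ hc) with ⟨j', hj', hI, s, -, h2, h3⟩ | ⟨h1, -⟩
  · have := hi.unique _ (by omega) (by omega) hI.coreZ
    obtain rfl : j' = j := by omega
    rw [h3]
    refine h.core_succ (IsCoreData.two_mul_le hm) (fun r hr => ?_) _
    rw [← h2 r hr, ← ht r hr, this]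
  · refine absurd ?_ (h1 j hj)
    rwa [show i + (j : ℤ) - j = i by ring]

theorem pad_left_step (h : IsCoreData z a p) (hm : m = 2 * p * (k + 1)) {X Y : ℤ → ℕ}
    (hs : Scheme.Step 𝓟 X Y) {i : ℤ} (hi : Isolated z a p m X i) {c : ℤ}
    (h1 : i - (m * p : ℕ) ≤ c) (h2 : c < i) : Y c = a := by
  refine pad_outer h hs (fun i' h3 h4 ⟨b, hb⟩ => ?_) fun i' hi' h3 h4 => ?_
  · have := isolated_zone h hm hb.1 hi
    omega
  · have := hi.unique i' (by omega) (by omega) hi'.coreZ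
    omega

theorem pad_right_step (h : IsCoreData z a p) (hm : m = 2 * p * (k + 1)) {X Y : ℤ → ℕ}
    (hs : Scheme.Step 𝓟 X Y) {i : ℤ} (hi : Isolated z a p m X i) {c : ℤ}
    (h1 : i + (m * p : ℕ) ≤ c) (h2 : c < i + 2 * (m * p : ℕ)) : Y c = a := by
  refine pad_outer h hs (fun i' h3 h4 ⟨b, hb⟩ => ?_) fun i' hi' h3 h4 => ?_
  · have := isolated_zone h hm hb.1 hi
    omega
  · have := hi.unique i' (by omega) (by omega) hi'.coreZ
    omega

/-- After one step, all cores are successors of isolated cores. -/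
theorem isolated_of_coreZ_step (h : IsCoreData z a p) (hm : m = 2 * p * (k + 1)) {X Y : ℤ → ℕ}
    (hs : Scheme.Step 𝓟 X Y) {i : ℤ} (hi : CoreZ z p m Y i) : Isolated z a p m X i := by
  refine coreZ_of_layout h hm (C := Isolated z a p m X) (Z := Scheme.Valid 𝓟 X) ?_
    (fun i hi c => pad_left_step h hm hs hi) (fun i hi c => pad_right_step h hm hs hi) ?_ ?_ hi
  · rintro i hi
    obtain ⟨t, ht⟩ := hi.coreZ
    exact ⟨t + 1, fun j hj => pad_core_step h hm hs hi ht hj⟩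
  · rintro i ⟨b, hb⟩
    exact (pad_zone_iff h).1 hb.1
  · intro c h1 h2
    exact pad_outer h hs (fun i h3 h4 hv => h2 i hv h3 h4) h1

theorem isolated_step (h : IsCoreData z a p) (hm : m = 2 * p * (k + 1)) {X Y : ℤ → ℕ}
    (hs : Scheme.Step 𝓟 X Y) {i : ℤ} : Isolated z a p m Y i ↔ Isolated z a p m X i := by
  refine ⟨fun hi => isolated_of_coreZ_step h hm hs hi.coreZ, fun hi => ⟨?_, ?_, ?_, ?_⟩⟩
  · obtain ⟨t, ht⟩ := hi.coreZ
    exact ⟨t + 1, fun j hj => pad_core_step h hm hs hi ht hj⟩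
  · exact fun c => pad_left_step h hm hs hi
  · exact fun c => pad_right_step h hm hs hi
  · exact fun i' h1 h2 hc => hi.unique i' h1 h2 (isolated_of_coreZ_step h hm hs hc).coreZ

theorem pad_zone_step (h : IsCoreData z a p) (hm : m = 2 * p * (k + 1)) {X Y : ℤ → ℕ}
    (hs : Scheme.Step 𝓟 X Y) {i : ℤ} : Scheme.Zone 𝓟 Y i ↔ Scheme.Zone 𝓟 X i := by
  rw [pad_zone_iff h, pad_zone_iff h, isolated_step h hm hs, isolated_step h hm hs]

theorem pad_persistent (h : IsCoreData z a p) (hm : m = 2 * p * (k + 1)) :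
    Scheme.Persistent 𝓟 := fun _ _ hs _ hi => (pad_zone_step h hm hs).2 hi

theorem pad_factor_of_not_valid (h : IsCoreData z a p) (hm : m = 2 * p * (k + 1)) {X Y : ℤ → ℕ}
    (hs : Scheme.Step 𝓟 X Y) {i : ℤ} (hz : Scheme.Zone 𝓟 X i) (hv : ¬ Scheme.Valid 𝓟 X i) :
    factorZ Y i k = List.replicate k a := by
  refine factorZ_eq_iff.2 ⟨List.length_replicate, fun j hj => ?_⟩
  rw [List.getD_eq_getElem _ _ (by simpa using hj), List.getElem_replicate]
  refine pad_outer h hs (fun i' h3 h4 hv' => ?_) fun i' hi' h3 h4 => ?_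
  · obtain ⟨b, hb⟩ := hv'
    have : i = i' := by
      rcases le_total i i' with hle | hle
      · exact pad_disjoint h hm _ _ _ hz hb.1 hle (show i' < i + (k : ℤ) by omega)
      · exact (pad_disjoint h hm _ _ _ hb.1 hz hle (show i < i' + (k : ℤ) by omega)).symm
    subst this
    exact hv ⟨b, hb⟩
  · have := isolated_zone h hm hz hi'
    omega

theorem pad_valid_step (h : IsCoreData z a p) (hm : m = 2 * p * (k + 1)) {X Y W : ℤ → ℕ}
    (hs : Scheme.Step 𝓟 X Y) (hs' : Scheme.Step 𝓟 Y W) {i : ℤ} :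
    Scheme.Valid 𝓟 W i ↔ Scheme.Valid 𝓟 Y i := by
  refine ⟨fun hW => ?_, fun hY => hY.step (pad_persistent h hm) hs'⟩
  by_contra hY
  obtain ⟨b, hb⟩ := hW
  have hzY := (pad_zone_step h hm hs').1 hb.1
  have hzX := (pad_zone_step h hm hs).1 hzY
  have hX : ¬ Scheme.Valid 𝓟 X i := fun hX => hY (hX.step (pad_persistent h hm) hs)
  refine hY ⟨b, hzY, ?_⟩
  rw [← hb.2]
  exact (pad_factor_of_not_valid h hm hs hzX hX).trans
    (pad_factor_of_not_valid h hm hs' hzY hY).symm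

theorem pad_trace (h : IsCoreData z a p) (hm : m = 2 * p * (k + 1))
    {S : Set (ℕ → ℕ)} (hS : ∀ y : ℤ → B, ∀ q < k,
      (fun t => (name ((pushZ rule)^[t] y 0)).getD q 0) ∈ S)
    (haS : (fun _ => a) ∈ S) (hzS : ∀ n, (fun t => z (n + t)) ∈ S)
    {X : ℕ → ℤ → ℕ} (hX : ∀ t, Scheme.Step 𝓟 (X t) (X (t + 1))) (c : ℤ) :
    (fun t => X (1 + t) c) ∈ S := by
  have hst : ∀ t i, Scheme.Valid 𝓟 (X (1 + t)) i ↔ Scheme.Valid 𝓟 (X 1) i := fun t i => by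
    induction t with
    | zero => rfl
    | succ t ih =>
      rw [← ih, show 1 + (t + 1) = t + 1 + 1 by ring, add_comm 1 t]
      exact pad_valid_step h hm (hX t) (hX (t + 1))
  have hI : ∀ t i, Isolated z a p m (X t) i ↔ Isolated z a p m (X 0) i := fun t i => by
    induction t with
    | zero => rfl
    | succ t ih => rw [← ih, isolated_step h hm (hX t)]
  refine Scheme.trace_mem (P := 𝓟) hS hX hst (fun c hc => ?_) c
  by_cases hC : ∃ i, Isolated z a p m (X 0) i ∧ i ≤ c ∧ c < i + (m * p : ℕ)
  · obtain ⟨i, hi, h1, h2⟩ := hC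
    obtain ⟨t₀, ht₀⟩ := hi.coreZ
    have key : ∀ t, ∀ j : ℕ, j < m * p → X t (i + j) = core z m (t₀ + t) j := fun t => by
      induction t with
      | zero => exact ht₀
      | succ t ih => exact fun j hj => pad_core_step h hm (hX t) ((hI t i).2 hi) ih hj
    convert hzS (t₀ + 1 + (c - i).toNat + (c - i).toNat / m) using 2 with t
    have := key (1 + t) (c - i).toNat (by omega)
    rw [show i + ((c - i).toNat : ℤ) = c by omega] at this
    rw [this]
    unfold core
    congr 1
    omega
  · push Not at hC
    convert haS using 2 with t
    rw [add_comm]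
    refine pad_outer h (hX t) (fun i h1 h2 hv => ?_) fun i hi h1 h2 => ?_
    · exact hc i h1 h2 ((hst t i).1 (by
        rw [add_comm]; exact hv.step (pad_persistent h hm) (hX t)))
    · exact absurd h2 (not_lt.2 (hC i ((hI t i).1 hi) h1))

/-- A border for `padScheme`. -/
def padWord (z : ℕ → ℕ) (a p m : ℕ) (j : ℕ) : ℕ :=
  if m * p ≤ j ∧ j < 2 * (m * p) then core z m 0 (j - m * p) else a

theorem pad_border_arrange (h : IsCoreData z a p) (hm : m = 2 * p * (k + 1)) (c : ℤ) (y : ℤ → B)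
    (n : ℤ) : Scheme.Border 𝓟 (Scheme.arrange 𝓟 (padWord z a p m) c y)
      (c + n * Scheme.gap 𝓟 + k) := by
  have hp := h.pos
  have hkM := h.add_le hm
  have hb : ∀ (n : ℤ) (j : ℕ), j < 3 * (m * p) → Scheme.arrange 𝓟 (padWord z a p m) c y
      (c + n * Scheme.gap 𝓟 + k + j) = padWord z a p m j := fun n j hj =>
    Scheme.arrange_border (P := 𝓟) hj
  have hg : Scheme.gap 𝓟 = k + 3 * (m * p : ℕ) := by
    simp [Scheme.gap, padScheme]
  set Y := Scheme.arrange 𝓟 (padWord z a p m) c y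
  set G := Scheme.gap 𝓟
  set M := m * p with hM
  have hb' : ∀ (n c' : ℤ) , c + n * G + k ≤ c' → c' < c + n * G + k + 3 * (M : ℤ) →
      ¬ (c + n * G + k + M ≤ c' ∧ c' < c + n * G + k + 2 * M) → Y c' = a := by
    intro n c' h1 h2 h3
    have := hb n (c' - (c + n * G + k)).toNat (by omega)
    rw [show c + n * G + k + ((c' - (c + n * G + k)).toNat : ℤ) = c' by omega] at this
    rw [this]
    unfold padWord
    rw [if_neg (by omega)]
  have h1 : ∀ n : ℤ, CoreZ z p m Y (c + n * G + k + M) := fun n => ⟨0, fun j hj => by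
    have := hb n (M + j) (by omega)
    rw [show c + n * G + k + ((M + j : ℕ) : ℤ) = c + n * G + k + M + j by push_cast; ring] at this
    rw [this]
    unfold padWord
    rw [if_pos (by omega)]
    congr 1
    omega⟩
  have hun : ∀ i, CoreZ z p m Y i → ∃ n : ℤ, i = c + n * G + k + M := fun i hi => by
    refine coreZ_of_layout h hm (C := fun i => ∃ n : ℤ, i = c + n * G + k + M)
      (Z := fun i => ∃ n : ℤ, i = c + n * G) ?_ ?_ ?_ ?_ ?_ hi
    · rintro i ⟨n, rfl⟩
      exact h1 n
    · rintro i ⟨n, rfl⟩ c' h2 h3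
      exact hb' n c' (by omega) (by omega) (by omega)
    · rintro i ⟨n, rfl⟩ c' h2 h3
      exact hb' n c' (by omega) (by omega) (by omega)
    · rintro i ⟨n, rfl⟩
      refine ⟨⟨n - 1, ?_⟩, n, rfl⟩
      rw [sub_mul, hg]
      ring
    · intro c' h2 h3
      have e1 := Int.emod_nonneg (c' - c) (show G ≠ 0 by omega)
      have e2 := Int.emod_lt_of_pos (c' - c) (show 0 < G by omega)
      have e3 := Int.emod_add_mul_ediv (c' - c) G
      have e4 : G * ((c' - c) / G) = (c' - c) / G * G := mul_comm _ _
      set n := (c' - c) / G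
      have h4 := h3 _ ⟨n, rfl⟩ (by omega)
      have h5 := h2 _ ⟨n, rfl⟩
      refine hb' n c' ?_ (by omega) fun h6 => h5 (by omega) (by omega)
      by_contra h6
      exact h4 (by omega)
  rw [pad_border_iff h]
  refine ⟨h1 n, fun c' h2 h3 => hb' n c' (by omega) (by omega) (by omega),
    fun c' h2 h3 => hb' n c' (by omega) (by omega) (by omega), fun i' h2 h3 h4 => ?_⟩
  obtain ⟨n', rfl⟩ := hun i' h4
  have hnn : n' = n := by
    have e1 : (n' - n) * G < G := by rw [sub_mul]; omega
    have e2 : (n - n') * G < G := by rw [sub_mul]; omega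
    have hG : 0 < G := by omega
    have e3 : n' - n < 1 := by nlinarith
    have e4 : n - n' < 1 := by nlinarith
    omega
  rw [hnn]

end Pad

/-! ### Traces and sofic subshifts -/

section Trace

theorem CA.trace_shift {A : Type*} (F : CA A) (n : ℕ) : Set.MapsTo (shift n) F.trace F.trace := by
  rintro z ⟨x, hx⟩
  refine ⟨F.step^[n] x, fun j => ?_⟩
  rw [← Function.iterate_add_apply, add_comm]
  exact hx (n + j)

theorem shift_shift_image {A : Type*} (S : Set (ℕ → A)) (m n : ℕ) :
    shift m '' (shift n '' S) = shift (n + m) '' S := by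
  rw [← Set.image_comp]
  congr 1
  funext z j
  simp [shift, add_assoc]

variable {A : Type*} [TopologicalSpace A]

theorem CA.trace_closed [Finite A] [DiscreteTopology A] (F : CA A) : IsClosed F.trace := by
  have hstep : Continuous F.step := continuous_pi fun i => by
    have h1 : Continuous F.rule := continuous_of_discreteTopology
    exact h1.comp (continuous_pi fun j => continuous_apply _)
  have hcont : Continuous fun (x : ℤ → A) (j : ℕ) => F.step^[j] x 0 :=
    continuous_pi fun j => (continuous_apply 0).comp (hstep.iterate j)
  have : F.trace = Set.range fun (x : ℤ → A) (j : ℕ) => F.step^[j] x 0 := by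
    ext z
    simp only [CA.trace, Set.mem_ofPred_eq, Set.mem_range, funext_iff, eq_comm]
  rw [this]
  exact (isCompact_range hcont).isClosed

/-- The subshift traced by a cellular automaton. -/
def CA.traceSubshift [Finite A] [DiscreteTopology A] (F : CA A) : Subshift A ℕ where
  carrier := F.trace
  isClosed := F.trace_closed
  mapsTo := F.trace_shift

variable {Γ : LabelledGraph A} {S : Subshift A ℕ}

theorem IsGraphOf.mem_of_edges (h : IsGraphOf Γ S) {E : ℕ → ℕ × A × ℕ} (hE : ∀ t, E t ∈ Γ)
    (hc : ∀ t, (E t).2.2 = (E (t + 1)).1) : (fun t => (E t).2.1) ∈ S.carrier := by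
  rw [IsGraphOf] at h
  rw [h]
  refine ⟨fun t => (E t).1, fun t => ?_⟩
  have := hE t
  rwa [show E t = ((E t).1, (E t).2.1, (E t).2.2) from rfl, hc t] at this

theorem IsGraphOf.exists_edges (h : IsGraphOf Γ S) {z : ℕ → A} (hz : z ∈ S.carrier) :
    ∃ E : ℕ → ℕ × A × ℕ, (∀ t, E t ∈ Γ) ∧ (∀ t, (E t).2.2 = (E (t + 1)).1) ∧
      ∀ t, (E t).2.1 = z t := by
  rw [IsGraphOf] at h
  rw [h] at hz
  obtain ⟨v, hv⟩ := hz
  exact ⟨fun t => (v t, z t, v (t + 1)), hv, fun _ => rfl, fun _ => rfl⟩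

/-- The images of a sofic subshift under the powers of the shift stabilize. -/
theorem IsGraphOf.shift_image_subset (h : IsGraphOf Γ S) (J : ℕ) :
    shift Γ.card '' S.carrier ⊆ shift (Γ.card + J) '' S.carrier := by
  rintro _ ⟨z, hz, rfl⟩
  obtain ⟨E, hE, hc, hl⟩ := h.exists_edges hz
  set n := Γ.card with hn
  obtain ⟨i, hi, j, hj, hij, heq⟩ := Finset.exists_ne_map_eq_of_card_lt_of_maps_to
    (s := Finset.range (n + 1)) (t := Γ) (f := E) (by simp [hn]) (fun t _ => hE t)
  wlog hlt : i < j generalizing i j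
  · exact this j hj i hi hij.symm heq.symm (by omega)
  rw [Finset.mem_range] at hi hj
  obtain ⟨L, rfl⟩ := Nat.exists_eq_add_of_lt hlt
  set p := L + 1 with hp
  set K := p * (J + n) with hK
  have hKle : J + n ≤ K := Nat.le_mul_of_pos_left _ (by omega)
  let f : ℕ → ℕ := fun t => if t < K then i + t % p else i + (t - K)
  have hf : ∀ t, (E (f t)).2.2 = (E (f (t + 1))).1 := by
    intro t
    have hwrap : t % p + 1 = p → (E (i + t % p)).2.2 = (E i).1 := fun hw => by
      rw [hc, add_assoc, hw, heq]
      rfl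
    have hmod := Nat.mod_lt t (show 0 < p by omega)
    rcases lt_trichotomy (t + 1) K with h1 | h1 | h1
    · have e1 : f t = i + t % p := if_pos (by omega)
      have e2 : f (t + 1) = i + (t + 1) % p := if_pos h1
      rw [e1, e2]
      rcases Nat.lt_or_ge (t % p + 1) p with h2 | h2
      · rw [hc, Nat.add_mod, Nat.mod_eq_of_lt (a := 1) (by omega), Nat.mod_eq_of_lt h2]
        rfl
      · have h3 : t % p + 1 = p := by omega
        rw [hwrap h3]
        have : (t + 1) % p = 0 := by
          rw [← Nat.mod_add_div t p, add_right_comm, h3, Nat.add_mul_mod_self_left, Nat.mod_self]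
        rw [this, add_zero]
    · have e1 : f t = i + t % p := if_pos (by omega)
      have e2 : f (t + 1) = i := by simp [f, h1]
      rw [e1, e2]
      refine hwrap ?_
      have h4 : (t + 1) % p = 0 := by rw [h1, hK, Nat.mul_mod_right]
      by_contra hne
      have h2 : t % p + 1 < p := by omega
      have : (t + 1) % p = t % p + 1 := by
        rw [Nat.add_mod, Nat.mod_eq_of_lt (a := 1) (by omega), Nat.mod_eq_of_lt h2]
      omega
    · have e1 : f t = i + (t - K) := if_neg (by omega)
      have e2 : f (t + 1) = i + (t - K) + 1 := by
        simp only [f]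
        rw [if_neg (by omega)]
        omega
      rw [e1, e2, hc]
  have hmem := h.mem_of_edges (E := fun t => E (f t)) (fun t => hE _) hf
  have hmem' := S.mapsTo (K - i - J) hmem
  refine ⟨_, hmem', ?_⟩
  funext t
  simp only [shift]
  rw [show f (K - i - J + (n + J + t)) = n + t by
    simp only [f]
    rw [if_neg (by omega)]
    omega, hl]

/-- A subshift between a sofic subshift and its preimage by some power of the shift. -/
theorem IsGraphOf.ultimatelyCoincide (h : IsGraphOf Γ S) {T : Subshift A ℕ}
    (h1 : S.carrier ⊆ T.carrier) {J : ℕ} (h2 : shift J '' T.carrier ⊆ S.carrier) :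
    UltimatelyCoincide S T := by
  refine ⟨J + Γ.card, (Set.image_mono h1).antisymm ?_⟩
  rw [← shift_shift_image]
  refine (Set.image_mono h2).trans ?_
  rw [add_comm]
  exact h.shift_image_subset J

end Trace

/-! ### Locality of the relations -/

section Local

theorem factor_congr {u u' : ℕ → ℕ} {s k N : ℕ} (h : ∀ j < N, u j = u' j) (hs : s + k ≤ N) :
    factor u s k = factor u' s k :=
  List.map_congr_left fun j hj => h _ (by have := List.mem_range.1 hj; omega)

theorem rotBorder_congr {η : ℕ → ℕ} {k : ℕ} {v v' : ℕ → ℕ} (h : ∀ j < k + 3, v j = v' j) :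
    RotBorder η k v ↔ RotBorder η k v' := by
  unfold RotBorder
  rw [h 0 (by omega), h (k + 2) (by omega)]
  refine and_congr_left' (forall₂_congr fun j hj => ?_)
  rw [h j (by omega)]

theorem coreAt_congr {z : ℕ → ℕ} {p m o N : ℕ} {v v' : ℕ → ℕ} (h : ∀ j < N, v j = v' j)
    (ho : o + m * p ≤ N) : CoreAt z p m v o ↔ CoreAt z p m v' o := by
  unfold CoreAt
  refine exists_congr fun t => and_congr_right fun _ => forall₂_congr fun j hj => ?_
  rw [h _ (by omega)]

theorem padBorder_congr {z : ℕ → ℕ} {a p m : ℕ} {v v' : ℕ → ℕ}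
    (h : ∀ j < 5 * (m * p), v j = v' j) : PadBorder z a p m v ↔ PadBorder z a p m v' := by
  unfold PadBorder
  rw [coreAt_congr h (by omega)]
  refine and_congr_right fun _ => and_congr (forall₂_congr fun j hj => ?_)
    (forall₂_congr fun o ho => ?_)
  · rw [h _ (by omega), h _ (by omega)]
  · rw [coreAt_congr h (by omega)]

theorem padRel_congr {z : ℕ → ℕ} {a p m rho n : ℕ} {u u' : ℕ → ℕ} (hr : 3 * (m * p) ≤ rho)
    (h : ∀ j < 2 * rho + 1, u j = u' j) :
    PadRel z a p m rho u n ↔ PadRel z a p m rho u' n := by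
  have hb : ∀ j < m * p, PadBorder z a p m (fun i => u (rho - j - 2 * (m * p) + i)) ↔
      PadBorder z a p m (fun i => u' (rho - j - 2 * (m * p) + i)) := fun j hj =>
    padBorder_congr fun i hi => h _ (by omega)
  unfold PadRel
  refine or_congr (exists_congr fun j => and_congr_right fun hj => and_congr (hb j hj) ?_)
    (and_congr_left' (forall₂_congr fun j hj => (hb j hj).not))
  refine exists_congr fun t => and_congr_right fun _ => and_congr_left' ?_
  refine forall₂_congr fun i hi => ?_
  rw [h _ (by omega)]

theorem localRel_congr {border : (ℕ → ℕ) → Prop} {Bl : List (List ℕ)}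
    {gt : List (List (List ℕ) × List ℕ)} {k D lam rho L : ℕ} {Hr : (ℕ → ℕ) → ℕ → Prop}
    (hb : ∀ v v' : ℕ → ℕ, (∀ j < L, v j = v' j) → (border v ↔ border v'))
    (hr : 2 * k + D + L ≤ rho + 1) {u u' : ℕ → ℕ} {n : ℕ} (h : ∀ j < 2 * rho + 1, u j = u' j)
    (hH : Hr u n ↔ Hr u' n) :
    LocalRel border Bl gt k D lam rho Hr u n ↔ LocalRel border Bl gt k D lam rho Hr u' n := by
  have hV : ∀ s, s ≤ rho + k + D → (ValidAt border Bl k D lam u s ↔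
      ValidAt border Bl k D lam u' s) := fun s hs => by
    unfold ValidAt
    rw [factor_congr h (by omega), hb _ (fun j => u' (s - D - lam + j)) fun j hj => h _ (by omega),
      hb (fun j => u (s + k - lam + j)) (fun j => u' (s + k - lam + j)) fun j hj => h _ (by omega)]
  unfold LocalRel
  refine or_congr (exists_congr fun q => and_congr_right fun hq => ?_)
    (and_congr (forall₂_congr fun q hq => (hV _ (by omega)).not) hH)
  rw [hV _ (by omega), hV _ (by omega), factor_congr h (by omega : rho - q + k ≤ 2 * rho + 1),
    factor_congr h (by omega : rho - q + k + D + k ≤ 2 * rho + 1)]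

theorem Input.rel_congr (I : Input) {u u' : ℕ → ℕ} {n : ℕ}
    (h : ∀ j < 2 * I.radius + 1, u j = u' j) : I.Rel u n ↔ I.Rel u' n := by
  have hr : I.radius = 4 * I.width + 10 + 20 * (I.block * I.walk.length) := rfl
  have hD : I.coreLength = I.block * I.walk.length := rfl
  unfold Input.Rel
  refine or_congr (and_congr_right fun _ => ?_) (or_congr (and_congr_right fun _ =>
    and_congr_right fun _ => ?_) Iff.rfl)
  · refine localRel_congr (L := I.width + 3) (fun v v' => rotBorder_congr) (by omega) h ?_
    rw [h _ (by omega)]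
  · exact localRel_congr (L := 5 * (I.block * I.walk.length)) (fun v v' => padBorder_congr)
      (by omega) h (padRel_congr (by omega) h)

end Local

/-! ### The automaton of a functional local relation -/

section Automaton

variable {A : Type*} {e : A → ℕ}

theorem Input.exists_ca (I : Input)
    (hal : ∀ n, n ∈ I.2.1.1 ↔ ∃ a, n = e a)
    (hfun : ∀ X : ℤ → ℕ, (∀ i, X i ∈ Set.range e) → ∀ c, ∃ n ∈ Set.range e, ∀ n',
      I.Rel (window X I.radius c) n' ↔ n' = n) :
    ∃ F : CA A, F.IsCodedBy e I.output ∧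
      ∀ (x : ℤ → A) (c : ℤ), I.Rel (window (fun i => e (x i)) I.radius c) (e (F.step x c)) := by
  have hu : ∀ u : Fin (2 * I.radius + 1) → A, ∃ a, ∀ n',
      I.Rel (fun j => (List.ofFn fun i => e (u i)).getD j 0) n' ↔ n' = e a := by
    intro u
    let X : ℤ → ℕ := fun i => if h : i.toNat < 2 * I.radius + 1 then e (u ⟨i.toNat, h⟩) else e (u 0)
    obtain ⟨_, ⟨a, rfl⟩, ha⟩ := hfun X (fun i => by
      simp only [X]; split_ifs <;> exact ⟨_, rfl⟩) I.radius
    refine ⟨a, fun n' => (I.rel_congr fun j hj => ?_).trans (ha n')⟩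
    rw [List.getD_eq_getElem _ _ (by simpa using hj), List.getElem_ofFn]
    simp only [window, X, sub_self, zero_add, Int.toNat_natCast, dif_pos hj]
  choose rule hrule using hu
  let F : CA A := ⟨I.radius, 2 * I.radius + 1, by omega, rule⟩
  refine ⟨F, ⟨hal, rfl, rfl, fun w a => ?_⟩, fun x c => ?_⟩
  · simp only [Input.output, List.mem_filter, List.mem_flatMap, List.mem_map, mem_allWords,
      decide_eq_true_eq, Prod.mk.injEq]
    constructor
    · rintro ⟨⟨w', ⟨hlen, hw⟩, n, hn, rfl, rfl⟩, hR⟩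
      have hex : ∀ i : Fin (2 * I.radius + 1), ∃ b, w'[i.1]'(by omega) = e b := fun i =>
        (hal _).1 (hw _ (List.getElem_mem _))
      choose u hu using hex
      have hw' : w' = List.ofFn fun i => e (u i) := by
        refine List.ext_getElem (by simp [hlen]) fun j h1 h2 => ?_
        rw [List.getElem_ofFn]
        exact hu ⟨j, by omega⟩
      rw [hw'] at hR
      exact ⟨u, hw', (hrule u n).1 hR⟩
    · rintro ⟨u, rfl, rfl⟩
      refine ⟨⟨_, ⟨by simp [F], fun n hn => ?_⟩, _, (hal _).2 ⟨_, rfl⟩, rfl, rfl⟩,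
        (hrule u _).2 rfl⟩
      obtain ⟨i, rfl⟩ := (List.mem_ofFn' _ _).1 hn
      exact (hal _).2 ⟨_, rfl⟩
  · refine (I.rel_congr fun j hj => ?_).1 ((hrule (fun j => x (c - I.radius + (j : ℕ))) _).2 rfl)
    rw [List.getD_eq_getElem _ _ (by simpa using hj), List.getElem_ofFn]
    rfl

end Automaton

/-! ### Periodic letters -/

section Letter

variable {A : Type*} {e : A → ℕ} {A' : Set A} {ξ : A' → A'} {xi : MapCode}

theorem look_eq (he : Function.Injective e) (h : IsMapCode e ξ xi) (a : A') :
    look xi (e a) = e (ξ a) := by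
  have hmem : (e a, e (ξ a)) ∈ xi := (h _ _).2 ⟨a, rfl, rfl⟩
  unfold look
  cases hl : xi.lookup (e a) with
  | none =>
    rw [List.lookup_eq_none_iff] at hl
    simpa using hl _ hmem
  | some m =>
    obtain ⟨l₁, l₂, h1, -⟩ := List.lookup_eq_some_iff.1 hl
    obtain ⟨b, hb, hb'⟩ := (h (e a) m).1 (by rw [h1]; simp)
    rw [Option.getD_some, hb', Subtype.ext (he hb)]

theorem look_iterate (he : Function.Injective e) (h : IsMapCode e ξ xi) (a : A') (t : ℕ) :
    (look xi)^[t] (e a) = e (ξ^[t] a) := by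
  induction t with
  | zero => rfl
  | succ t ih => rw [Function.iterate_succ_apply', Function.iterate_succ_apply', ih, look_eq he h]

theorem exists_cyclePoint (he : Function.Injective e) (h : IsMapCode e ξ xi) (hne : A'.Nonempty) :
    ∃ a : A', cyclePoint xi = e a := by
  obtain ⟨a, ha⟩ := hne
  have hmem : (e a, e (ξ ⟨a, ha⟩)) ∈ xi := (h _ _).2 ⟨⟨a, ha⟩, rfl, rfl⟩
  have hhead : (xi.headI.1, xi.headI.2) ∈ xi := by
    cases xi with
    | nil => simp at hmem
    | cons x l => simp
  obtain ⟨b, hb, -⟩ := (h _ _).1 hhead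
  exact ⟨_, by unfold cyclePoint; rw [hb, look_iterate he h]⟩

theorem cyclePoint_periodic (he : Function.Injective e) (h : IsMapCode e ξ xi)
    (hne : A'.Nonempty) :
    ∃ q, 0 < q ∧ q ≤ xi.length ∧ (look xi)^[q] (cyclePoint xi) = cyclePoint xi := by
  obtain ⟨a, ha⟩ := hne
  have hmem : (e a, e (ξ ⟨a, ha⟩)) ∈ xi := (h _ _).2 ⟨⟨a, ha⟩, rfl, rfl⟩
  have hhead : (xi.headI.1, xi.headI.2) ∈ xi := by
    cases xi with
    | nil => simp at hmem
    | cons x l => simp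
  obtain ⟨b, hb, -⟩ := (h _ _).1 hhead
  obtain ⟨i, hi, j, hj, hij, heq⟩ := Finset.exists_ne_map_eq_of_card_lt_of_maps_to
    (s := Finset.range (xi.length + 1)) (t := (xi.map Prod.fst).toFinset)
    (f := fun t => (look xi)^[t] xi.headI.1)
    (by
      have := List.toFinset_card_le (xi.map Prod.fst)
      rw [List.length_map] at this
      rw [Finset.card_range]
      omega)
    (fun t _ => by
      simp only [hb, look_iterate he h]
      exact Finset.mem_coe.2 (List.mem_toFinset.2 (List.mem_map.2
        ⟨_, (h _ _).2 ⟨ξ^[t] b, rfl, rfl⟩, rfl⟩)))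
  wlog hlt : i < j generalizing i j
  · exact this j hj i hi hij.symm heq.symm (by omega)
  rw [Finset.mem_range] at hi hj
  refine ⟨j - i, by omega, by omega, ?_⟩
  unfold cyclePoint
  rw [← Function.iterate_add_apply, show j - i + xi.length = xi.length - i + j by omega,
    Function.iterate_add_apply, ← heq, ← Function.iterate_add_apply,
    show xi.length - i + i = xi.length by omega]

theorem mem_cycleList (he : Function.Injective e) (h : IsMapCode e ξ xi) (hne : A'.Nonempty)
    (t : ℕ) : (look xi)^[t] (cyclePoint xi) ∈ cycleList xi := by
  obtain ⟨q, hq, hle, hper⟩ := cyclePoint_periodic he h hne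
  have := Nat.mod_lt t hq
  refine List.mem_map.2 ⟨t % q, List.mem_range.2 (by omega), ?_⟩
  conv_rhs => rw [← Nat.mod_add_div t q, Function.iterate_add_apply, Function.iterate_mul,
    Function.iterate_fixed hper]

theorem rotation_iterate (he : Function.Injective e) (h : IsMapCode e ξ xi) (hne : A'.Nonempty)
    (c : ℕ) : ∃ s, ∀ t, (rotation xi)^[t + 1] c = (look xi)^[s + t] (cyclePoint xi) := by
  have h1 : ∃ s, rotation xi c = (look xi)^[s] (cyclePoint xi) := by
    unfold rotation
    split_ifs with hc
    · obtain ⟨s, -, rfl⟩ := List.mem_map.1 hc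
      exact ⟨s + 1, (Function.iterate_succ_apply' _ _ _).symm⟩
    · exact ⟨0, rfl⟩
  obtain ⟨s, hs⟩ := h1
  refine ⟨s, fun t => ?_⟩
  induction t with
  | zero => exact hs
  | succ t ih =>
    rw [Function.iterate_succ_apply', ih, ← add_assoc, Function.iterate_succ_apply']
    exact if_pos (mem_cycleList he h hne _)

theorem rotation_period (he : Function.Injective e) (h : IsMapCode e ξ xi) (hne : A'.Nonempty) :
    ∃ q, 0 < q ∧ (rotation xi)^[1 + q] = (rotation xi)^[1] := by
  obtain ⟨q, hq, -, hper⟩ := cyclePoint_periodic he h hne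
  refine ⟨q, hq, funext fun c => ?_⟩
  obtain ⟨s, hs⟩ := rotation_iterate he h hne c
  rw [add_comm, hs, show (1 : ℕ) = 0 + 1 from rfl, hs, Function.iterate_add_apply, hper, add_zero]

theorem rotation_ne (he : Function.Injective e) (h : IsMapCode e ξ xi) (hne : A'.Nonempty)
    (hb : look xi (cyclePoint xi) ≠ cyclePoint xi) (c : ℕ) : rotation xi c ≠ c := by
  obtain ⟨q, hq, -, hper⟩ := cyclePoint_periodic he h hne
  unfold rotation
  split_ifs with hc
  · obtain ⟨s, -, rfl⟩ := List.mem_map.1 hc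
    intro heq
    refine hb ?_
    have hsq : (look xi)^[q * s] (cyclePoint xi) = cyclePoint xi := by
      rw [Function.iterate_mul, Function.iterate_fixed hper]
    have hle : s ≤ q * s := Nat.le_mul_of_pos_left _ hq
    have h1 : (look xi)^[q * s] (cyclePoint xi) = (look xi)^[q * s - s]
        ((look xi)^[s] (cyclePoint xi)) := by
      rw [← Function.iterate_add_apply, Nat.sub_add_cancel hle]
    rw [Function.iterate_fixed heq] at h1
    rw [← hsq, h1]
    exact heq
  · exact fun heq => hc (heq ▸ mem_cycleList he h hne 0)

end Letter

/-! ### Closed walks -/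

section Walk

variable {E : List (ℕ × ℕ × ℕ)} {a : ℕ}

theorem findWalk_spec (h : findWalk E a ≠ []) :
    IsClosedWalk a (findWalk E a) ∧ ∀ x ∈ findWalk E a, x ∈ E := by
  classical
  have hmem : ∀ l : List (List (ℕ × ℕ × ℕ)), l.headI ≠ [] → l.headI ∈ l := fun l hl => by
    cases l with
    | nil => exact absurd rfl hl
    | cons x l => simp
  have := hmem _ h
  change findWalk E a ∈ _ at this
  simp only [List.mem_filter, List.mem_flatMap, mem_allWords, decide_eq_true_eq] at this
  obtain ⟨⟨n, -, -, h1⟩, h2⟩ := this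
  exact ⟨h2, h1⟩

theorem findWalk_ne_nil {w : List (ℕ × ℕ × ℕ)} (hw : IsClosedWalk a w) (hE : ∀ x ∈ w, x ∈ E)
    (hl : w.length ≤ E.length) : findWalk E a ≠ [] := by
  classical
  have hmem : ∀ l : List (List (ℕ × ℕ × ℕ)), w ∈ l → l.headI ∈ l := fun l hl => by
    cases l with
    | nil => simp at hl
    | cons x l => simp
  have := hmem (((List.range (E.length + 1)).flatMap fun n => allWords E n).filter
    fun w => IsClosedWalk a w) (by
      simp only [List.mem_filter, List.mem_flatMap, mem_allWords, decide_eq_true_eq]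
      exact ⟨⟨w.length, List.mem_range.2 (by omega), rfl, hE⟩, hw⟩)
  change findWalk E a ∈ _ at this
  simp only [List.mem_filter, decide_eq_true_eq] at this
  intro h
  obtain ⟨i, hi, -⟩ := this.2.2
  rw [h] at hi
  simp at hi

/-- The sequence `f 0, …, f (L - 1)` is a closed walk with a label different from `a`. -/
structure ClosedSeq (a : ℕ) (f : ℕ → ℕ × ℕ × ℕ) (L : ℕ) : Prop where
  chain : ∀ t, t + 1 < L → (f t).2.2 = (f (t + 1)).1
  wrap : (f (L - 1)).2.2 = (f 0).1
  label : ∃ t < L, (f t).2.1 ≠ a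

/-- Closed walks can be shortened. -/
theorem ClosedSeq.exists_walk {f : ℕ → ℕ × ℕ × ℕ} {L : ℕ} (h : ClosedSeq a f L)
    (hE : ∀ t < L, f t ∈ E) :
    ∃ w, IsClosedWalk a w ∧ (∀ x ∈ w, x ∈ E) ∧ w.length ≤ E.length := by
  induction L using Nat.strong_induction_on generalizing f with
  | _ L ih =>
  rcases le_or_gt L E.length with hL | hL
  · have hget : ∀ i < L, ((List.range L).map f).getD i default = f i := fun i hi => by
      simp [hi]
    refine ⟨(List.range L).map f, ⟨fun i hi => ?_, ?_⟩, ?_, by simpa using hL⟩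
    · simp only [List.length_map, List.length_range] at hi ⊢
      have hlt := Nat.mod_lt (i + 1) (show 0 < L by omega)
      rw [hget i hi, hget _ hlt]
      rcases Nat.lt_or_ge (i + 1) L with h1 | h1
      · rw [Nat.mod_eq_of_lt h1, h.chain i h1]
      · obtain rfl : i = L - 1 := by omega
        rw [show L - 1 + 1 = L by omega, Nat.mod_self, h.wrap]
    · obtain ⟨t, ht, h1⟩ := h.label
      exact ⟨t, by simpa using ht, by rw [hget t ht]; exact h1⟩
    · intro x hx
      obtain ⟨t, ht, rfl⟩ := List.mem_map.1 hx
      exact hE t (List.mem_range.1 ht)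
  · obtain ⟨i, hi, j, hj, hij, heq⟩ := Finset.exists_ne_map_eq_of_card_lt_of_maps_to
      (s := Finset.range L) (t := E.toFinset) (f := f)
      (by
        have := List.toFinset_card_le E
        rw [Finset.card_range]
        omega)
      (fun t ht => Finset.mem_coe.2 (List.mem_toFinset.2
        (hE t (Finset.mem_range.1 (Finset.mem_coe.1 ht)))))
    wlog hlt : i < j generalizing i j
    · exact this j hj i hi hij.symm heq.symm (by omega)
    rw [Finset.mem_range] at hi hj
    obtain ⟨t, ht, hlab⟩ := h.label
    by_cases hin : i ≤ t ∧ t < j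
    · refine ih (j - i) (by omega) (f := fun s => f (i + s)) ⟨fun s hs => ?_, ?_,
        t - i, by omega, ?_⟩ fun s hs => hE _ (by omega)
      · exact h.chain _ (by omega)
      · have := h.chain (i + (j - i - 1)) (by omega)
        rw [this, show i + (j - i - 1) + 1 = j by omega, ← heq]
        rfl
      · rwa [show i + (t - i) = t by omega]
    · refine ih (L - (j - i)) (by omega)
        (f := fun s => if s < i then f s else f (s + (j - i))) ⟨fun s hs => ?_, ?_, ?_⟩
        fun s hs => ?_
      · rcases lt_trichotomy (s + 1) i with h1 | h1 | h1
        · simp only [if_pos h1, if_pos (show s < i by omega)]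
          exact h.chain s (by omega)
        · simp only [if_neg (show ¬ s + 1 < i by omega), if_pos (show s < i by omega)]
          rw [h.chain s (by omega), h1, heq, show i + (j - i) = j by omega]
        · simp only [if_neg (show ¬ s + 1 < i by omega), if_neg (show ¬ s < i by omega)]
          rw [h.chain _ (by omega), add_right_comm]
      · have e1 : (if L - (j - i) - 1 < i then f (L - (j - i) - 1)
            else f (L - (j - i) - 1 + (j - i))) = f (L - 1) := by
          rw [if_neg (by omega)]
          congr 1
          omega
        have e2 : (if 0 < i then f 0 else f (0 + (j - i))) = f 0 := by
          split_ifs with h0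
          · rfl
          · obtain rfl : i = 0 := by omega
            rw [heq]
            congr 1
            omega
        rw [e1, e2, h.wrap]
      · by_cases h1 : t < i
        · exact ⟨t, by omega, by rwa [if_pos h1]⟩
        · refine ⟨t - (j - i), by omega, ?_⟩
          rwa [if_neg (by omega), show t - (j - i) + (j - i) = t by omega]
      · split_ifs
        · exact hE _ (by omega)
        · exact hE _ (by omega)

variable {A : Type*} [TopologicalSpace A] {e : A → ℕ} {Γ : LabelledGraph A} {S : Subshift A ℕ}
  {c : SoficCode}

/-- The labels of a closed walk form a periodic element of the subshift. -/
theorem walkLabel_mem (hΓ : IsGraphOf Γ S) (hc : IsSoficCode e Γ c) {w : List (ℕ × ℕ × ℕ)}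
    (hw : IsClosedWalk a w) (hE : ∀ x ∈ w, x ∈ c.2) (n : ℕ) :
    ∃ z ∈ S.carrier, ∀ t, walkLabel w (n + t) = e (z t) := by
  obtain ⟨i, hi, -⟩ := hw.2
  have hpos : 0 < w.length := by omega
  have hmem : ∀ t, w.getD (t % w.length) default ∈ c.2 := fun t => by
    have := Nat.mod_lt t hpos
    rw [List.getD_eq_getElem _ _ this]
    exact hE _ (List.getElem_mem _)
  have hex : ∀ t, ∃ b, ((w.getD (t % w.length) default).1, b,
      (w.getD (t % w.length) default).2.2) ∈ Γ ∧ (w.getD (t % w.length) default).2.1 = e b :=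
    fun t => (hc.2 _ _ _).1 (hmem t)
  choose b hb hb' using hex
  refine ⟨_, hΓ.mem_of_edges (E := fun t => ((w.getD ((n + t) % w.length) default).1, b (n + t),
    (w.getD ((n + t) % w.length) default).2.2)) (fun t => hb _) (fun t => ?_), fun t => hb' _⟩
  simp only
  rw [hw.1 _ (Nat.mod_lt _ hpos), Nat.mod_add_mod, add_assoc]

theorem isCoreData_walkLabel {w : List (ℕ × ℕ × ℕ)} (hw : IsClosedWalk a w) :
    IsCoreData (walkLabel w) a w.length := by
  obtain ⟨i, hi, h1⟩ := hw.2
  refine ⟨by omega, fun j => ?_, i, ?_⟩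
  · unfold walkLabel
    rw [Nat.add_mod_right]
  · unfold walkLabel
    rwa [Nat.mod_eq_of_lt hi]

/-- If the graph has no closed walk with a label different from `b`, then the elements of the
subshift have few letters different from `b`. -/
theorem few_labels (he : Function.Injective e) (hΓ : IsGraphOf Γ S) (hc : IsSoficCode e Γ c)
    {b : A} (hw : findWalk c.2 (e b) = []) {z : ℕ → A} (hz : z ∈ S.carrier) :
    {t | z t ≠ b}.Finite ∧ {t | z t ≠ b}.ncard ≤ Γ.card := by
  obtain ⟨E, hE, hch, hl⟩ := hΓ.exists_edges hz
  have key : ∀ s t, s < t → z s ≠ b → E s ≠ E t := fun s t hst hs heq => by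
    let f : ℕ → ℕ × ℕ × ℕ := fun r => ((E (s + r)).1, e (E (s + r)).2.1, (E (s + r)).2.2)
    obtain ⟨w, h1, h2, h3⟩ := ClosedSeq.exists_walk (a := e b) (f := f) (L := t - s) (E := c.2)
      ⟨fun r _ => hch _, by
        simp only [f]
        rw [hch, show s + (t - s - 1) + 1 = t by omega, ← heq]
        rfl, 0, by omega, fun h => hs (by
          rw [← hl s]; exact he h)⟩
      fun r _ => (hc.2 _ _ _).2 ⟨_, hE _, rfl⟩
    exact findWalk_ne_nil h1 h2 h3 hw
  have hinj : Set.InjOn E {t | z t ≠ b} := fun s hs t ht heq => by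
    rcases lt_trichotomy s t with h | h | h
    · exact absurd heq (key s t h hs)
    · exact h
    · exact absurd heq.symm (key t s h ht)
  have hmaps : Set.MapsTo E {t | z t ≠ b} (Γ : Set (ℕ × A × ℕ)) := fun t _ => hE t
  refine ⟨Set.Finite.of_finite_image (Γ.finite_toSet.subset hmaps.image_subset) hinj, ?_⟩
  rw [← Set.ncard_coe_finset]
  exact Set.ncard_le_ncard_of_injOn E hmaps hinj Γ.finite_toSet

end Walk

/-! ### Proof of the theorem -/

section WordName

variable {A : Type*} {e : A → ℕ}

theorem length_wordName {k : ℕ} {B : Set (Fin k → A)} (b : B) : (wordName e b).length = k := by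
  simp [wordName]

theorem getD_wordName {k : ℕ} {B : Set (Fin k → A)} (b : B) (q : Fin k) :
    (wordName e b).getD q 0 = e (b.1 q) := by
  simp [wordName]

theorem wordName_injective (he : Function.Injective e) {k : ℕ} {B : Set (Fin k → A)} :
    Function.Injective (wordName e (B := B)) := fun b b' h => by
  refine Subtype.ext (funext fun q => he ?_)
  rw [← getD_wordName (e := e) b q, h, getD_wordName]

theorem mem_wordName {k : ℕ} {B : Set (Fin k → A)} (b : B) {n : ℕ} (h : n ∈ wordName e b) :
    n ∈ Set.range e := by
  obtain ⟨i, rfl⟩ := (List.mem_ofFn' _ _).1 h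
  exact ⟨_, rfl⟩

end WordName

theorem CA.exists_rule {B : Type*} (G : CA B) (h0 : G.anchor = 0) (h2 : G.diam = 2) :
    ∃ g : B → B → B, G.step = pushZ g ∧ ∀ (ν : B → List ℕ) w v,
      (∃ u : Fin G.diam → B, w = List.ofFn (fun i => ν (u i)) ∧ v = ν (G.rule u)) ↔
        ∃ b b', w = [ν b, ν b'] ∧ v = ν (g b b') := by
  obtain ⟨anchor, diam, hpos, rule⟩ := G
  simp only at h0 h2
  subst h0 h2
  refine ⟨fun b b' => rule ![b, b'], ?_, fun ν w v => ⟨?_, ?_⟩⟩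
  · funext x i
    simp only [CA.step, pushZ]
    congr 1
    funext j
    fin_cases j <;> simp
  · rintro ⟨u, rfl, rfl⟩
    refine ⟨u 0, u 1, by simp, ?_⟩
    congr 2
    funext j
    fin_cases j <;> simp
  · rintro ⟨b, b', rfl, rfl⟩
    exact ⟨![b, b'], by simp, rfl⟩

section Main

variable {A : Type*} [TopologicalSpace A] {e : A → ℕ} {S : Subshift A ℕ}

/-- The sequences of the names of the letters of the elements of a subshift. -/
def names (e : A → ℕ) (S : Subshift A ℕ) : Set (ℕ → ℕ) :=
  {s | ∃ z ∈ S.carrier, ∀ t, s t = e (z t)}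

theorem Scheme.ultimatelyCoincide [Finite A] [DiscreteTopology A] {B : Type*} {P : Scheme B}
    (he : Function.Injective e) {Γ : LabelledGraph A} (hΓ : IsGraphOf Γ S)
    (hper : P.Persistent) {w : ℕ → ℕ}
    (hw : ∀ (c : ℤ) (y : ℤ → B) (n : ℤ), P.Border (P.arrange w c y) (c + n * P.gap + P.k))
    (hwA : ∀ j < P.D, w j ∈ Set.range e) (hA : ∀ b, ∀ n ∈ P.name b, n ∈ Set.range e)
    {F : CA A} (hF : ∀ x, P.Step (fun i => e (x i)) (fun i => e (F.step x i)))
    (hS : ∀ z ∈ S.carrier, ∃ y : ℤ → B, ∃ q < P.k,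
      ∀ t, (P.name ((pushZ P.rule)^[t] y 0)).getD q 0 = e (z t))
    {J : ℕ} (hJ : ∀ X : ℕ → ℤ → ℕ, (∀ t, P.Step (X t) (X (t + 1))) →
      ∀ c, (fun t => X (J + t) c) ∈ names e S) :
    UltimatelyCoincide S F.traceSubshift := by
  have horb : ∀ (x : ℤ → A) (t : ℕ), P.Step (fun i => e (F.step^[t] x i))
      (fun i => e (F.step^[t + 1] x i)) := fun x t => by
    simp only [Function.iterate_succ_apply']
    exact hF _
  refine hΓ.ultimatelyCoincide (J := J) (fun z hz => ?_) ?_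
  · obtain ⟨y, q, hq, hy⟩ := hS z hz
    have hg : P.gap = P.k + P.D := rfl
    have hmem := arrange_mem (P := P) hA hwA (by omega) (-(q : ℤ)) y
    choose x hx using hmem
    refine ⟨x, fun t => he ?_⟩
    rw [← hy, ← trace_arrange hper hw hq y (horb x) (funext hx) t]
  · rintro _ ⟨z, ⟨x, hx⟩, rfl⟩
    obtain ⟨z', hz', h⟩ := hJ _ (horb x) 0
    convert hz' using 1
    funext t
    refine he ?_
    rw [← h]
    exact congrArg e (hx (J + t))

/-- A polytraced subshift whose elements have a bounded number of letters other than `a` is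
ultimately reduced to the constant sequence `a`. -/
theorem exists_forall_eq [Finite A] {k : ℕ} {B : Set (Fin k → A)} {G : CA B} {g : B → B → B}
    (hstep : G.step = pushZ g) (hpoly : G.polytrace = S.carrier) {a : A} {C : ℕ}
    (hfew : ∀ z ∈ S.carrier, {t | z t ≠ a}.Finite ∧ {t | z t ≠ a}.ncard ≤ C)
    (hne : S.carrier.Nonempty) : ∃ T, ∀ z ∈ S.carrier, ∀ t ≥ T, z t = a := by
  classical
  have hext : ∀ (y : ℕ → B) (t n : ℕ), (pushZ g)^[t] (fun i : ℤ => y i.toNat) n =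
      (push g)^[t] y n := by
    intro y t
    induction t with
    | zero => intro n; rfl
    | succ t ih =>
      intro n
      rw [Function.iterate_succ_apply', Function.iterate_succ_apply']
      simp only [push, ← ih]
      rfl
  have hmem : ∀ (y : ℕ → B) (q : Fin k), (fun t => ((push g)^[t] y 0).1 q) ∈ S.carrier := by
    intro y q
    rw [← hpoly]
    refine Set.mem_iUnion.2 ⟨q, fun t => (push g)^[t] y 0, ⟨fun i => y i.toNat, fun t => ?_⟩, rfl⟩
    rw [hstep]
    exact (hext y t 0).symm
  have hfin : ∀ y : ℕ → B, {t | ((push g)^[t] y 0).1 ≠ fun _ => a}.Finite ∧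
      {t | ((push g)^[t] y 0).1 ≠ fun _ => a}.ncard ≤ k * C := by
    intro y
    have hU : {t | ((push g)^[t] y 0).1 ≠ fun _ => a} =
        ⋃ q : Fin k, {t | ((push g)^[t] y 0).1 q ≠ a} := by
      ext t
      simp [Function.ne_iff]
    rw [hU]
    refine ⟨Set.finite_iUnion fun q => (hfew _ (hmem y q)).1, ?_⟩
    refine (Set.ncard_iUnion_le_of_fintype _).trans ?_
    refine (Finset.sum_le_card_nsmul _ _ C fun q _ => (hfew _ (hmem y q)).2).trans ?_
    simp
  obtain ⟨z₀, hz₀⟩ := hne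
  rw [← hpoly] at hz₀
  obtain ⟨q₀, -, ⟨x₀, -⟩, -⟩ := Set.mem_iUnion.1 hz₀
  let y₀ : ℕ → B := fun n => x₀ n
  have hω : ∃ t, ((push g)^[t] y₀ 0).1 = (fun _ => a) ∧
      ((push g)^[t] (fun n => y₀ (1 + n)) 0).1 = (fun _ => a) ∧
      ((push g)^[t + 1] y₀ 0).1 = fun _ => a := by
    have h1 := (hfin y₀).1
    have h2 := (hfin fun n => y₀ (1 + n)).1
    have h3 : {t | ((push g)^[t + 1] y₀ 0).1 ≠ fun _ => a}.Finite :=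
      h1.preimage (f := fun t => t + 1) fun s _ t _ h => by simpa using h
    obtain ⟨t, ht⟩ := ((h1.union h2).union h3).exists_notMem
    simp only [Set.mem_union, Set.mem_ofPred_eq, not_or, not_not] at ht
    exact ⟨t, ht.1.1, ht.1.2, ht.2⟩
  obtain ⟨t₀, h1, h2, h3⟩ := hω
  let ω : B := (push g)^[t₀] y₀ 0
  have hωa : ∀ b : B, b.1 = (fun _ => a) ↔ b = ω := fun b =>
    ⟨fun h => Subtype.ext (h.trans h1.symm), fun h => by rw [h]; exact h1⟩
  have hgω : g ω ω = ω := by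
    have h4 := (hωa _).1 h3
    rw [Function.iterate_succ_apply'] at h4
    have h5 : (push g)^[t₀] y₀ (0 + 1) = ω := by
      rw [push_iterate_shift]
      exact (hωa _).1 h2
    simp only [push] at h4
    rw [h5] at h4
    exact h4
  simp only [ne_eq, hωa] at hfin
  obtain ⟨T, hT⟩ := nilpotent_of_bounded hgω hfin
  refine ⟨T, fun z hz t ht => ?_⟩
  rw [← hpoly] at hz
  obtain ⟨q, z', ⟨x, hx⟩, rfl⟩ := Set.mem_iUnion.1 hz
  have h4 := (hωa _).2 (hT (fun n => x n) t ht)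
  have h5 : G.step^[t] x 0 = (push g)^[t] (fun n : ℕ => x n) 0 := by
    rw [hstep]
    have : ∀ t (n : ℕ), (pushZ g)^[t] x n = (push g)^[t] (fun n : ℕ => x n) n := by
      intro t
      induction t with
      | zero => intro n; rfl
      | succ t ih =>
        intro n
        rw [Function.iterate_succ_apply', Function.iterate_succ_apply']
        simp only [push, ← ih]
        rfl
    exact this t 0
  simp only [hx t, h5, h4]

end Main

end CATrace

open CATrace in
theorem propositionp :
    ∃ f : CACode (List ℕ) × SoficCode × MapCode → CACode ℕ, Computable f ∧
      ∀ (A : Type*) [Finite A] [TopologicalSpace A] [DiscreteTopology A]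
        (e : A → ℕ) (_ : Function.Injective e)
        (S : SymbolicDynamics.FullShift.Subshift A ℕ)
        (k : ℕ) (B : Set (Fin k → A)) (G : CA B) (_ : G.Polytraces S)
        (Γ : LabelledGraph A) (_ : IsGraphOf Γ S)
        (A' : Set A) (_ : A'.Nonempty) (ξ : A' → A') (_ : deterministic ξ ⊆ S.carrier)
        (cG : CACode (List ℕ)) (_ : G.IsCodedBy (wordName e) cG)
        (cS : SoficCode) (_ : IsSoficCode e Γ cS)
        (cξ : MapCode) (_ : IsMapCode e ξ cξ),
        ∃ (F : CA A) (T : SymbolicDynamics.FullShift.Subshift A ℕ),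
          F.IsCodedBy e (f (cG, cS, cξ)) ∧ F.Traces T ∧ UltimatelyCoincide S T := by
  refine ⟨Input.output, Input.computable_output, ?_⟩
  intro A _ _ _ e he S k B G hG Γ hΓ A' hA' ξ hξ cG hcG cS hcS cξ hcξ
  obtain ⟨h0, h2, hpoly⟩ := hG
  obtain ⟨g, hstep, htab⟩ := G.exists_rule h0 h2
  obtain ⟨hB, -, -, hgt⟩ := hcG
  have hgt := fun w v => (hgt w v).trans (htab _ w v)
  set I : Input := (cG, cS, cξ) with hI
  obtain ⟨α, hα⟩ := exists_cyclePoint he hcξ hA'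
  have hdet : ∀ (a : A') (n : ℕ), (fun t => e (ξ^[n + t] a)) ∈ names e S := fun a n =>
    ⟨_, hξ ⟨ξ^[n] a, fun _ => rfl⟩, fun t => by
      beta_reduce
      rw [add_comm, Function.iterate_add_apply]⟩
  have hSne : S.carrier.Nonempty := ⟨_, hξ ⟨α, fun _ => rfl⟩⟩
  have hS1 : ∀ y : ℤ → B, ∀ q < k,
      (fun t => (wordName e ((pushZ g)^[t] y 0)).getD q 0) ∈ names e S := by
    intro y q hq
    refine ⟨fun t => ((pushZ g)^[t] y 0).1 ⟨q, hq⟩, ?_, fun t => getD_wordName _ ⟨q, hq⟩⟩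
    rw [← hpoly]
    exact Set.mem_iUnion.2 ⟨⟨q, hq⟩, fun t => (pushZ g)^[t] y 0, ⟨y, fun t => by rw [hstep]⟩, rfl⟩
  have hS2 : ∀ z ∈ S.carrier, ∃ y : ℤ → B, ∃ q < k,
      ∀ t, (wordName e ((pushZ g)^[t] y 0)).getD q 0 = e (z t) := by
    intro z hz
    rw [← hpoly] at hz
    obtain ⟨q, z', ⟨y, hy⟩, rfl⟩ := Set.mem_iUnion.1 hz
    refine ⟨y, q, q.2, fun t => ?_⟩
    rw [getD_wordName, ← hstep, ← hy]
  have hwidth : I.width = k := by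
    obtain ⟨z, hz⟩ := hSne
    obtain ⟨y, -⟩ := hS2 z hz
    have hmem : wordName e (y 0) ∈ cG.1 := (hB _).2 ⟨_, rfl⟩
    have hhead : cG.1.headI ∈ cG.1 := by
      cases h : cG.1 with
      | nil => rw [h] at hmem; simp at hmem
      | cons x l => simp
    obtain ⟨b, hb⟩ := (hB _).1 hhead
    change cG.1.headI.length = k
    rw [hb, length_wordName]
  have hrad : I.radius = 4 * I.width + 10 + 20 * (I.block * I.walk.length) := rfl
  rw [hwidth] at hrad
  have hletter : I.letter = e α := hα
  have hletter_mem : I.letter ∈ Set.range e := ⟨_, hletter.symm⟩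
  by_cases hrot : look I.2.2 I.letter = I.letter
  · have haS : (fun _ => I.letter) ∈ names e S := by
      have hfix : ξ α = α := by
        rw [hletter, look_eq he hcξ] at hrot
        exact Subtype.ext (he hrot)
      convert hdet α 0 using 2 with t
      rw [Function.iterate_fixed hfix, hletter]
    by_cases hw : I.walk = []
    · have hRel : ∀ u n, I.Rel u n ↔ n = I.letter := fun u n => by
        simp [Input.Rel, hrot, hw]
      obtain ⟨F, hF1, hF2⟩ := I.exists_ca hcS.1 fun X _ c =>
        ⟨I.letter, hletter_mem, fun n' => hRel _ _⟩
      have hconst : ∀ x c, F.step x c = α := fun x c => he (by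
        rw [(hRel _ _).1 (hF2 x c), hletter])
      refine ⟨F, F.traceSubshift, hF1, rfl, ?_⟩
      have hwalk : findWalk cS.2 (e α) = [] := hletter ▸ hw
      obtain ⟨T, hT⟩ := exists_forall_eq hstep hpoly (fun z hz => few_labels he hΓ hcS hwalk hz) hSne
      have hone : ∀ U : Set (ℕ → A), U.Nonempty → (∀ z ∈ U, ∀ t ≥ T + 1, z t = α) →
          SymbolicDynamics.FullShift.shift (T + 1) '' U = {fun _ => (α : A)} := by
        intro U hU h
        refine (Set.Nonempty.subset_singleton_iff (hU.image _)).1 ?_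
        rintro _ ⟨z, hz, rfl⟩
        exact funext fun t => h z hz _ (Nat.le_add_right _ _)
      refine ⟨T + 1, ?_⟩
      rw [hone _ hSne fun z hz t ht => hT z hz t (by omega), hone]
      · exact ⟨_, fun _ => α, fun _ => rfl⟩
      · rintro z ⟨x, hx⟩ t ht
        obtain ⟨r, rfl⟩ := Nat.exists_eq_add_of_le' ht
        rw [hx, ← add_assoc, Function.iterate_succ_apply']
        exact hconst _ _
    · obtain ⟨hcw, hEw⟩ := findWalk_spec hw
      have hcore : IsCoreData (walkLabel I.walk) I.letter I.walk.length :=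
        isCoreData_walkLabel hcw
      have hm : I.block = 2 * I.walk.length * (k + 1) := by rw [← hwidth]; rfl
      have hzS : ∀ n, (fun t => walkLabel I.walk (n + t)) ∈ names e S := fun n => by
        obtain ⟨z, hz, h⟩ := walkLabel_mem hΓ hcS hcw hEw n
        exact ⟨z, hz, h⟩
      have hzA : ∀ j, walkLabel I.walk j ∈ Set.range e := fun j => by
        obtain ⟨z, -, h⟩ := hzS j
        exact ⟨z 0, (h 0).symm⟩
      let P : Scheme B := padScheme (walkLabel I.walk) I.letter I.walk.length I.block k I.radius
        (wordName e) g (wordName_injective he) length_wordName (by omega)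
      have hdis : P.Disjoint := pad_disjoint hcore hm
      have hRel : ∀ u n, I.Rel u n ↔
          LocalRel P.border cG.1 cG.2.2.2 P.k P.D P.lam P.rho P.outer u n := fun u n => by
        unfold Input.Rel
        rw [hwidth]
        simp only [hrot, hw, ne_eq, not_true_eq_false, false_and, not_false_eq_true, true_and,
          or_false, false_or]
        rfl
      obtain ⟨F, hF1, hF2⟩ := I.exists_ca hcS.1 fun X hX c => by
        simp only [hRel]
        exact P.existsUnique_localRel hB hgt hdis (fun b n => mem_wordName b)
          (fun X c _ => padRel_existsUnique hcore (IsCoreData.two_mul_le hm)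
            (by omega : k + 4 * (I.block * I.walk.length) ≤ I.radius) hletter_mem hzA X c) hX c
      refine ⟨F, F.traceSubshift, hF1, rfl, ?_⟩
      refine Scheme.ultimatelyCoincide (P := P) he hΓ (pad_persistent hcore hm)
        (w := padWord (walkLabel I.walk) I.letter I.walk.length I.block)
        (fun c y n => pad_border_arrange hcore hm c y n) (fun j _ => ?_)
        (fun b n => mem_wordName b)
        (fun x => Scheme.step_of_localRel hB hgt hdis fun c => (hRel _ _).1 (hF2 x c)) hS2 (J := 1)
        fun X hX c => pad_trace hcore hm hS1 haS hzS hX c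
      unfold padWord
      split_ifs
      · exact hzA _
      · exact hletter_mem
  · have hη : ∀ c, rotation I.2.2 c ≠ c := rotation_ne he hcξ hA' hrot
    obtain ⟨q, hq0, hq⟩ := rotation_period he hcξ hA'
    have hηS : ∀ n c, (fun t => (rotation I.2.2)^[n + 1 + t] c) ∈ names e S := fun n c => by
      obtain ⟨s, hs⟩ := rotation_iterate he hcξ hA' c
      convert hdet α (s + n) using 2 with t
      rw [add_right_comm, hs, hα, look_iterate he hcξ, add_assoc]
    have hηA : ∀ c, rotation I.2.2 c ∈ Set.range e := fun c => by
      obtain ⟨z, -, h⟩ := hηS 0 c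
      exact ⟨z 0, (h 0).symm⟩
    let P : Scheme B := rotScheme (rotation I.2.2) k I.radius
      (wordName e) g (wordName_injective he) length_wordName (by omega)
    have hdis : P.Disjoint := rot_disjoint hη
    have hRel : ∀ u n, I.Rel u n ↔
        LocalRel P.border cG.1 cG.2.2.2 P.k P.D P.lam P.rho P.outer u n := fun u n => by
      unfold Input.Rel
      rw [hwidth]
      simp only [hrot, ne_eq, not_false_eq_true, false_and, true_and, or_false]
      rfl
    obtain ⟨F, hF1, hF2⟩ := I.exists_ca hcS.1 fun X hX c => by
      simp only [hRel]
      exact P.existsUnique_localRel hB hgt hdis (fun b n => mem_wordName b)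
        (fun X c _ => ⟨_, hηA _, fun n' => Iff.rfl⟩) hX c
    refine ⟨F, F.traceSubshift, hF1, rfl, ?_⟩
    refine Scheme.ultimatelyCoincide (P := P) he hΓ (rot_persistent hη)
      (w := rotWord (rotation I.2.2) k (e α))
      (fun c y n => rot_border_arrange (e α) c y n) (fun j _ => ?_)
      (fun b n => mem_wordName b)
      (fun x => Scheme.step_of_localRel hB hgt hdis fun c => (hRel _ _).1 (hF2 x c)) hS2
      fun X hX c => rot_trace hη hq0 hq hS1 hηS hX c
    unfold rotWord
    split_ifs
    · exact ⟨_, rfl⟩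
    · exact hηA _
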